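/- Let $(\mathcal{C},\mathbb{E},\mathfrak{s})$ be an extriangulated category (in the sense of Nakaoka–Palu), and let $\mathcal{M}$ be a full subcategory of $\mathcal{C}$ that is closed under finite direct sums (up to isomorphism) and rigid, i.e. $\mathbb{E}(M,M')=0$ for all $M,M'\in\mathcal{M}$. Let $\mathcal{P}$ (resp. $\mathcal{I}$) be the full subcategory of projective (resp. injective) objects of $\mathcal{C}$: those with the lifting property for all $\mathfrak{s}$-deflations (resp. the extension property for all $\mathfrak{s}$-inflations). For full subcategories $\mathcal{C}',\mathcal{C}''$ of $\mathcal{C}$, let $\mathrm{Cocone}(\mathcal{C}',\mathcal{C}'')$ (resp. $\mathrm{Cone}(\mathcal{C}',\mathcal{C}'')$) be the full subcategory of all objects $X$ admitting an $\mathfrak{s}$-triangle $X\to C'\to C''\dashrightarrow$ (resp. $C'\to C''\to X\dashrightarrow$) with $C'\in\mathcal{C}'$ and $C''\in\mathcal{C}''$. Put $$\mathcal{M}_L=\mathrm{Cocone}(\mathcal{M},\mathcal{M}),\quad \Omega\mathcal{M}=\mathrm{Cocone}(\mathcal{P},\mathcal{M}),\quad \mathcal{M}_R=\mathrm{Cone}(\mathcal{M},\mathcal{M}),\quad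 \Sigma\mathcal{M}=\mathrm{Cone}(\mathcal{M},\mathcal{I}).$$ For a full subcategory $\mathcal{D}$ of an additive category $\mathcal{A}$, let $\mathcal{A}/[\mathcal{D}]$ be the quotient of $\mathcal{A}$ by the ideal $[\mathcal{D}]$ generated by the morphisms that factor through an object of $\mathcal{D}$ (when $\mathcal{D}$ is non-empty and closed under direct sums, as in all cases below, $[\mathcal{D}]$ consists exactly of these morphisms). Let $\mathrm{mod}\text{-}\mathcal{A}$ be the category of finitely presented right $\mathcal{A}$-modules, i.e. of the additive functors $F:\mathcal{A}^{\mathrm{op}}\to\mathrm{Ab}$ for which there is an exact sequence $\mathcal{A}(-,X)\to\mathcal{A}(-,Y)\to F\to 0$ with $X,Y\in\mathcal{A}$. (1) If $\mathcal{C}$ has enough projectives and $\mathcal{P}\subseteq\mathcal{M}$, then there are equivalences of categories $$\mathcal{M}_L/[\mathcal{M}]\simeq\mathrm{mod}\text{-}(\mathcal{M}/[\mathcal{P}])\quad\text{and}\quad \mathcal{M}_L/[\Omega\mathcal{M}]\simeq\bigl(\mathrm{mod}\text{-}(\mathcal{M}/[\mathcal{P}])^{\mathrm{op}}\bigr)^{\mathrm{op}}.$$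 (2) If $\mathcal{C}$ has enough injectives and $\mathcal{I}\subseteq\mathcal{M}$, then there are equivalences of categories $$\mathcal{M}_R/[\mathcal{M}]\simeq\bigl(\mathrm{mod}\text{-}(\mathcal{M}/[\mathcal{I}])^{\mathrm{op}}\bigr)^{\mathrm{op}}\quad\text{and}\quad \mathcal{M}_R/[\Sigma\mathcal{M}]\simeq\mathrm{mod}\text{-}(\mathcal{M}/[\mathcal{I}]).$$ -/

import Mathlib

universe w v u

open CategoryTheory CategoryTheory.Limits Opposite

namespace ExtriangulatedQuotients

/-! ### Additive bifunctors and extensions -/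

section Extensions

variable {C : Type u} [Category.{v} C]

/-- The group `𝔼(Z, A)` of extensions, for a bifunctor `𝔼 : Cᵒᵖ × C → Ab` (in curried form). -/
abbrev Ext (E : Cᵒᵖ ⥤ C ⥤ AddCommGrpCat.{w}) (Z A : C) : Type w :=
  (E.obj (op Z)).obj A

/-- `a_* δ`. -/
def push (E : Cᵒᵖ ⥤ C ⥤ AddCommGrpCat.{w}) {Z A A' : C} (a : A ⟶ A') (δ : Ext E Z A) :
    Ext E Z A' :=
  ((E.obj (op Z)).map a).hom δ

/-- `c^* δ`. -/
def pull (E : Cᵒᵖ ⥤ C ⥤ AddCommGrpCat.{w}) {Z Z' A : C} (c : Z' ⟶ Z) (δ : Ext E Z A) :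
    Ext E Z' A :=
  ((E.map c.op).app A).hom δ

/-- `δ ⊕ δ'`, the element of `𝔼(Z ⊕ Z', A ⊕ A')` corresponding to `(δ, 0, 0, δ')`. -/
noncomputable def extSum [Preadditive C] [HasBinaryBiproducts C]
    (E : Cᵒᵖ ⥤ C ⥤ AddCommGrpCat.{w}) {Z Z' A A' : C}
    (δ : Ext E Z A) (δ' : Ext E Z' A') : Ext E (Z ⊞ Z') (A ⊞ A') :=
  push E biprod.inl (pull E biprod.fst δ) + push E biprod.inr (pull E biprod.snd δ')

end Extensions

/-! ### Extriangulated categories -/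

/-- An extriangulated structure `(𝔼, 𝔰)` on an additive category `C`.
`IsTriangle x y δ` says that `𝔰(δ)` is the equivalence class of the sequence `x, y`, that is, that
`A ⟶ B ⟶ Z` together with `δ ∈ 𝔼(Z, A)` is an `𝔰`-triangle; the first three fields about
`IsTriangle` say that `𝔰` sends each extension to exactly one equivalence class of sequences. -/
structure Extriangulated (C : Type u) [Category.{v} C] [Preadditive C] [HasZeroObject C]
    [HasBinaryBiproducts C] where
  /-- The bifunctor `𝔼`, additive in both variables. -/
  E : Cᵒᵖ ⥤ C ⥤ AddCommGrpCat.{w}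
  additive_left : E.Additive
  additive_right : ∀ Z : Cᵒᵖ, (E.obj Z).Additive
  IsTriangle : ∀ {A B Z : C}, (A ⟶ B) → (B ⟶ Z) → Ext E Z A → Prop
  exists_triangle : ∀ {A Z : C} (δ : Ext E Z A),
    ∃ (B : C) (x : A ⟶ B) (y : B ⟶ Z), IsTriangle x y δ
  triangle_of_equivalent : ∀ {A B B' Z : C} {x : A ⟶ B} {y : B ⟶ Z} {x' : A ⟶ B'} {y' : B' ⟶ Z}
    {δ : Ext E Z A}, IsTriangle x y δ →
      ∀ b : B ≅ B', x ≫ b.hom = x' → b.hom ≫ y' = y → IsTriangle x' y' δ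
  triangle_unique : ∀ {A B B' Z : C} {x : A ⟶ B} {y : B ⟶ Z} {x' : A ⟶ B'} {y' : B' ⟶ Z}
    {δ : Ext E Z A}, IsTriangle x y δ → IsTriangle x' y' δ →
      ∃ b : B ≅ B', x ≫ b.hom = x' ∧ b.hom ≫ y' = y
  /-- Every morphism of extensions is realized by a morphism of sequences. -/
  realize_hom : ∀ {A B Z A' B' Z' : C} {x : A ⟶ B} {y : B ⟶ Z} {δ : Ext E Z A}
    {x' : A' ⟶ B'} {y' : B' ⟶ Z'} {δ' : Ext E Z' A'},
    IsTriangle x y δ → IsTriangle x' y' δ' →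
      ∀ (a : A ⟶ A') (c : Z ⟶ Z'), push E a δ = pull E c δ' →
        ∃ b : B ⟶ B', x ≫ b = a ≫ x' ∧ y ≫ c = b ≫ y'
  /-- Additivity of the realization, first part: split sequences realize zero. -/
  triangle_zero : ∀ A Z : C,
    IsTriangle (biprod.inl : A ⟶ A ⊞ Z) (biprod.snd : A ⊞ Z ⟶ Z) (0 : Ext E Z A)
  /-- Additivity of the realization, second part. -/
  triangle_sum : ∀ {A B Z A' B' Z' : C} {x : A ⟶ B} {y : B ⟶ Z} {δ : Ext E Z A}
    {x' : A' ⟶ B'} {y' : B' ⟶ Z'} {δ' : Ext E Z' A'},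
    IsTriangle x y δ → IsTriangle x' y' δ' →
      IsTriangle (biprod.map x x') (biprod.map y y') (extSum E δ δ')
  /-- (ET3) -/
  et3 : ∀ {A B Z A' B' Z' : C} {x : A ⟶ B} {y : B ⟶ Z} {δ : Ext E Z A}
    {x' : A' ⟶ B'} {y' : B' ⟶ Z'} {δ' : Ext E Z' A'},
    IsTriangle x y δ → IsTriangle x' y' δ' →
      ∀ (a : A ⟶ A') (b : B ⟶ B'), x ≫ b = a ≫ x' →
        ∃ c : Z ⟶ Z', y ≫ c = b ≫ y' ∧ push E a δ = pull E c δ'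
  /-- (ET3)ᵒᵖ -/
  et3_op : ∀ {A B Z A' B' Z' : C} {x : A ⟶ B} {y : B ⟶ Z} {δ : Ext E Z A}
    {x' : A' ⟶ B'} {y' : B' ⟶ Z'} {δ' : Ext E Z' A'},
    IsTriangle x y δ → IsTriangle x' y' δ' →
      ∀ (b : B ⟶ B') (c : Z ⟶ Z'), y ≫ c = b ≫ y' →
        ∃ a : A ⟶ A', x ≫ b = a ≫ x' ∧ push E a δ = pull E c δ'
  /-- (ET4) -/
  et4 : ∀ {A B D Y F : C} {f : A ⟶ B} {f' : B ⟶ D} {δ : Ext E D A}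
    {g : B ⟶ Y} {g' : Y ⟶ F} {δ' : Ext E F B},
    IsTriangle f f' δ → IsTriangle g g' δ' →
      ∃ (X : C) (h : A ⟶ Y) (h' : Y ⟶ X) (d : D ⟶ X) (e : X ⟶ F) (δ'' : Ext E X A),
        f ≫ g = h ∧ f' ≫ d = g ≫ h' ∧ h' ≫ e = g' ∧
        IsTriangle h h' δ'' ∧ IsTriangle d e (push E f' δ') ∧
        δ = pull E d δ'' ∧ push E f δ'' = pull E e δ'
  /-- (ET4)ᵒᵖ -/
  et4_op : ∀ {D A B F Y : C} {f' : D ⟶ A} {f : A ⟶ B} {δ : Ext E B D}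
    {g' : F ⟶ B} {g : B ⟶ Y} {δ' : Ext E Y F},
    IsTriangle f' f δ → IsTriangle g' g δ' →
      ∃ (X : C) (h' : X ⟶ A) (h : A ⟶ Y) (d : D ⟶ X) (e : X ⟶ F) (δ'' : Ext E Y X),
        f ≫ g = h ∧ d ≫ h' = f' ∧ h' ≫ f = e ≫ g' ∧
        IsTriangle h' h δ'' ∧ IsTriangle d e (pull E g' δ) ∧
        δ' = push E e δ'' ∧ push E d δ = pull E g δ''

namespace Extriangulated

variable {C : Type u} [Category.{v} C] [Preadditive C] [HasZeroObject C] [HasBinaryBiproducts C]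
variable (S : Extriangulated.{w} C)

/-- `x` and `y` form an `𝔰`-conflation. -/
def IsConflation {A B Z : C} (x : A ⟶ B) (y : B ⟶ Z) : Prop :=
  ∃ δ : Ext S.E Z A, S.IsTriangle x y δ

def IsInflation {A B : C} (x : A ⟶ B) : Prop :=
  ∃ (Z : C) (y : B ⟶ Z), S.IsConflation x y

def IsDeflation {B Z : C} (y : B ⟶ Z) : Prop :=
  ∃ (A : C) (x : A ⟶ B), S.IsConflation x y

/-- The class `𝒫` of projective objects. -/
def projectives : ObjectProperty C := fun P =>
  ∀ ⦃B Z : C⦄ (y : B ⟶ Z), S.IsDeflation y → ∀ c : P ⟶ Z, ∃ b : P ⟶ B, b ≫ y = c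

/-- The class `ℐ` of injective objects. -/
def injectives : ObjectProperty C := fun I =>
  ∀ ⦃A B : C⦄ (x : A ⟶ B), S.IsInflation x → ∀ a : A ⟶ I, ∃ b : B ⟶ I, x ≫ b = a

def EnoughProjectives : Prop :=
  ∀ Z : C, ∃ (A P : C) (x : A ⟶ P) (y : P ⟶ Z), S.projectives P ∧ S.IsConflation x y

def EnoughInjectives : Prop :=
  ∀ A : C, ∃ (I Z : C) (x : A ⟶ I) (y : I ⟶ Z), S.injectives I ∧ S.IsConflation x y

/-- `Cocone(C', C'')`: objects `X` with an `𝔰`-triangle `X ⟶ C' ⟶ C''`. -/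
def cocone (P Q : ObjectProperty C) : ObjectProperty C := fun X =>
  ∃ (Y Z : C) (x : X ⟶ Y) (y : Y ⟶ Z), P Y ∧ Q Z ∧ S.IsConflation x y

/-- `Cone(C', C'')`: objects `X` with an `𝔰`-triangle `C' ⟶ C'' ⟶ X`. -/
def cone (P Q : ObjectProperty C) : ObjectProperty C := fun X =>
  ∃ (Y Z : C) (x : Y ⟶ Z) (y : Z ⟶ X), P Y ∧ Q Z ∧ S.IsConflation x y

/-- `𝔼(M, M') = 0` for all `M, M'` in the subcategory. -/
def IsRigid (M : ObjectProperty C) : Prop :=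
  ∀ ⦃X Y : C⦄, M X → M Y → ∀ δ : Ext S.E X Y, δ = 0

end Extriangulated

/-- Closure (up to isomorphism) under direct sums of two objects. -/
def ClosedUnderDirectSums {C : Type u} [Category.{v} C] [Preadditive C] [HasBinaryBiproducts C]
    (M : ObjectProperty C) : Prop :=
  ∀ ⦃X Y : C⦄, M X → M Y → ∃ Z : C, M Z ∧ Nonempty (Z ≅ X ⊞ Y)

/-! ### Ideal quotients -/

section IdealQuotient

variable {A : Type u} [Category.{v} A] [Preadditive A]

/-- The morphism `f` factors through an object of `D`. -/
def FactorsThrough (D : ObjectProperty A) {X Y : A} (f : X ⟶ Y) : Prop :=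
  ∃ (Z : A) (g : X ⟶ Z) (h : Z ⟶ Y), D Z ∧ g ≫ h = f

/-- `[D](X, Y)`, where `[D]` is the ideal generated by the morphisms that factor through objects
of `D`. If `D` contains a zero object and is closed under direct sums, this is the set of
morphisms that factor through an object of `D`, see `mem_factorIdeal_iff`. -/
def factorIdeal (D : ObjectProperty A) (X Y : A) : AddSubgroup (X ⟶ Y) :=
  AddSubgroup.closure {f | FactorsThrough D f}

lemma mem_factorIdeal_iff [HasBinaryBiproducts A] {D : ObjectProperty A}
    (h0 : ∃ Z, D Z) (hD : ClosedUnderDirectSums D) {X Y : A} (f : X ⟶ Y) :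
    f ∈ factorIdeal D X Y ↔ FactorsThrough D f := by
  refine ⟨fun hf => ?_, fun hf => AddSubgroup.subset_closure hf⟩
  induction hf using AddSubgroup.closure_induction with
  | mem f hf => exact hf
  | zero =>
    obtain ⟨Z, hZ⟩ := h0
    exact ⟨Z, 0, 0, hZ, by simp⟩
  | add f g _ _ hf hg =>
    obtain ⟨Z, a, b, hZ, rfl⟩ := hf
    obtain ⟨Z', a', b', hZ', rfl⟩ := hg
    obtain ⟨W, hW, ⟨e⟩⟩ := hD hZ hZ'
    exact ⟨W, biprod.lift a a' ≫ e.inv, e.hom ≫ biprod.desc b b', hW, by simp⟩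
  | neg f _ hf =>
    obtain ⟨Z, a, b, hZ, rfl⟩ := hf
    exact ⟨Z, -a, b, hZ, by simp⟩

lemma comp_mem_factorIdeal (D : ObjectProperty A) {X Y Z : A} (f : X ⟶ Y) {g : Y ⟶ Z}
    (hg : g ∈ factorIdeal D Y Z) : f ≫ g ∈ factorIdeal D X Z := by
  induction hg using AddSubgroup.closure_induction with
  | mem g hg =>
    obtain ⟨W, a, b, hW, rfl⟩ := hg
    exact AddSubgroup.subset_closure ⟨W, f ≫ a, b, hW, by simp⟩
  | zero => simp
  | add g g' _ _ h h' => simpa using add_mem h h'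
  | neg g _ h => simpa using h

lemma mem_factorIdeal_comp (D : ObjectProperty A) {X Y Z : A} {f : X ⟶ Y} (g : Y ⟶ Z)
    (hf : f ∈ factorIdeal D X Y) : f ≫ g ∈ factorIdeal D X Z := by
  induction hf using AddSubgroup.closure_induction with
  | mem f hf =>
    obtain ⟨W, a, b, hW, rfl⟩ := hf
    exact AddSubgroup.subset_closure ⟨W, a, b ≫ g, hW, by simp⟩
  | zero => simp
  | add g g' _ _ h h' => simpa using add_mem h h'
  | neg g _ h => simpa using h

/-- Two parallel morphisms are identified when their difference lies in `[D]`. -/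
def idealRel (D : ObjectProperty A) : HomRel A := fun X Y f g => f - g ∈ factorIdeal D X Y

instance (D : ObjectProperty A) : Congruence (idealRel D) where
  equivalence := ⟨fun f => by simp [idealRel],
    fun {f g} h => by simpa [idealRel] using neg_mem (show f - g ∈ _ from h),
    fun {f g k} h h' => by
      simpa [idealRel] using add_mem (show f - g ∈ _ from h) (show g - k ∈ _ from h')⟩
  comp_left := fun f _ _ h => by
    simpa [idealRel] using comp_mem_factorIdeal D f h
  comp_right := fun g h => by
    simpa [idealRel] using mem_factorIdeal_comp D g h

/-- The ideal quotient `A/[D]`: the objects of `A`, with morphism groups `A(X, Y)/[D](X, Y)`. -/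
abbrev IdealQuotient (D : ObjectProperty A) : Type u := CategoryTheory.Quotient (idealRel D)

instance (D : ObjectProperty A) : Preadditive (IdealQuotient D) :=
  CategoryTheory.Quotient.preadditive (idealRel D) fun X Y f₁ f₂ g₁ g₂ h h' => by
    have := add_mem (show f₁ - f₂ ∈ factorIdeal D X Y from h) (show g₁ - g₂ ∈ _ from h')
    simpa [idealRel, add_sub_add_comm] using this

/-- For subcategories `N` and `D` of `A` (with `D` contained in `N` in the intended use), the ideal
quotient `N/[D]`. -/
abbrev SubQuotient (N D : ObjectProperty A) : Type u :=
  IdealQuotient (D.inverseImage N.ι)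

end IdealQuotient

/-! ### Finitely presented modules -/

/-- A contravariant functor `F : Aᵒᵖ ⥤ Ab` is a finitely presented right `A`-module if it is
additive and there is an exact sequence `A(-, X) ⟶ A(-, Y) ⟶ F ⟶ 0`. -/
def IsFinitelyPresentedModule (A : Type u) [Category.{v} A] [Preadditive A] :
    ObjectProperty (Aᵒᵖ ⥤ AddCommGrpCat.{v}) := fun F =>
  F.Additive ∧ ∃ (X Y : A) (f : preadditiveYoneda.obj X ⟶ preadditiveYoneda.obj Y)
    (p : preadditiveYoneda.obj Y ⟶ F), ∀ Z : Aᵒᵖ,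
      Function.Exact (f.app Z).hom (p.app Z).hom ∧ Function.Surjective (p.app Z).hom

/-- `mod-A`, the category of finitely presented right `A`-modules. -/
abbrev FpMod (A : Type u) [Category.{v} A] [Preadditive A] : Type (max u (v + 1)) :=
  (IsFinitelyPresentedModule A).FullSubcategory

end ExtriangulatedQuotients

/-! Choose for `X` in `M_L` a triangle `X ⟶ Y ⟶ Z` with extension `δ` and `Y`, `Z` in `M`, and view
`y : Y ⟶ Z` as a morphism of `M/[𝒫]`. Since `𝔼(-, Y)` vanishes on `M`, the cokernel of `(-, Y) ⟶ (-,
Z)` over `M/[𝒫]` is `𝔼(-, X)` restricted to `M`; dually, the cokernel of `(Z, -) ⟶ (Y, -)` is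
`Hom(X, -)` modulo projectives, restricted to `M`. These two modules give the two equivalences of
(1).

Maps of finitely presented modules are commutative squares between presentations modulo homotopy, so
everything reduces to comparing morphisms `φ : X ⟶ X'` with such squares; `Presentation` records
what is needed. Fullness is (ET3)ᵒᵖ, after a square commuting up to projectives is made strict
(`IsTriangle.exists_hom`). Density holds because adding a deflation from a projective turns any `Y ⟶
Z` into a deflation, without changing it in `M/[𝒫]` (`Resolution.exists_iso`).

The kernels tell the equivalences apart. By rigidity `φ` factors through `M` iff `φ_* δ = 0`, that
is, iff the component `Z ⟶ Z'` lifts along `y'` up to projectives. It factors through `ΩM` iff the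
component `Y ⟶ Y'` factors through `y` up to projectives (`IsTriangle.factorsThrough_cocone`,
`IsTriangle.exists_factorsThrough`).

Part (2) is part (1) for the opposite extriangulated category. -/

namespace ExtriangulatedQuotients

/-! ### Functoriality of extensions -/

section Extensions

variable {C : Type u} [Category.{v} C] (E : Cᵒᵖ ⥤ C ⥤ AddCommGrpCat.{w})

@[simp]
lemma push_id {Z A : C} (δ : Ext E Z A) : push E (𝟙 A) δ = δ := by
  simp [push]

@[simp]
lemma pull_id {Z A : C} (δ : Ext E Z A) : pull E (𝟙 Z) δ = δ := by
  simp [pull]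

lemma push_comp {Z A A' A'' : C} (a : A ⟶ A') (a' : A' ⟶ A'') (δ : Ext E Z A) :
    push E (a ≫ a') δ = push E a' (push E a δ) := by
  simp [push]

lemma pull_comp {Z Z' Z'' A : C} (c : Z' ⟶ Z) (c' : Z'' ⟶ Z') (δ : Ext E Z A) :
    pull E (c' ≫ c) δ = pull E c' (pull E c δ) := by
  simp [pull]

lemma pull_push {Z Z' A A' : C} (a : A ⟶ A') (c : Z' ⟶ Z) (δ : Ext E Z A) :
    pull E c (push E a δ) = push E a (pull E c δ) := by
  have := ConcreteCategory.congr_hom ((E.map c.op).naturality a) δ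
  exact this

@[simp]
lemma push_zero {Z A A' : C} (a : A ⟶ A') : push E a (0 : Ext E Z A) = 0 :=
  map_zero _

@[simp]
lemma pull_zero {Z Z' A : C} (c : Z' ⟶ Z) : pull E c (0 : Ext E Z A) = 0 :=
  map_zero _

lemma push_add {Z A A' : C} (a : A ⟶ A') (δ δ' : Ext E Z A) :
    push E a (δ + δ') = push E a δ + push E a δ' :=
  map_add _ _ _

lemma pull_add {Z Z' A : C} (c : Z' ⟶ Z) (δ δ' : Ext E Z A) :
    pull E c (δ + δ') = pull E c δ + pull E c δ' :=
  map_add _ _ _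

end Extensions

/-! ### Biproducts in the opposite category -/

section Opposite

variable {C : Type u} [Category.{v} C] [Preadditive C] [HasBinaryBiproducts C]

/-- The comparison of biproducts in a category and in its opposite. -/
noncomputable def biprodUnopIso (A A' : Cᵒᵖ) : A.unop ⊞ A'.unop ≅ (A ⊞ A').unop where
  hom := biprod.desc (biprod.fst : A ⊞ A' ⟶ A).unop (biprod.snd : A ⊞ A' ⟶ A').unop
  inv := biprod.lift (biprod.inl : A ⟶ A ⊞ A').unop (biprod.inr : A' ⟶ A ⊞ A').unop
  hom_inv_id := by ext <;> simp [← unop_comp]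
  inv_hom_id := by
    simp only [biprod.lift_desc, ← unop_comp, ← unop_add, biprod.total, unop_id]

@[simp]
lemma biprodUnopIso_hom_inl (A A' : Cᵒᵖ) :
    (biprodUnopIso A A').hom ≫ (biprod.inl : A ⟶ A ⊞ A').unop = biprod.fst := by
  ext <;> simp [biprodUnopIso, ← unop_comp]

@[simp]
lemma inl_biprodUnopIso_hom (A A' : Cᵒᵖ) :
    biprod.inl ≫ (biprodUnopIso A A').hom = (biprod.fst : A ⊞ A' ⟶ A).unop := by
  simp [biprodUnopIso]

@[simp]
lemma inr_biprodUnopIso_hom (A A' : Cᵒᵖ) :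
    biprod.inr ≫ (biprodUnopIso A A').hom = (biprod.snd : A ⊞ A' ⟶ A').unop := by
  simp [biprodUnopIso]

@[simp]
lemma biprodUnopIso_inv_fst (A A' : Cᵒᵖ) :
    (biprodUnopIso A A').inv ≫ biprod.fst = (biprod.inl : A ⟶ A ⊞ A').unop := by
  simp [biprodUnopIso]

@[simp]
lemma biprodUnopIso_inv_snd (A A' : Cᵒᵖ) :
    (biprodUnopIso A A').inv ≫ biprod.snd = (biprod.inr : A' ⟶ A ⊞ A').unop := by
  simp [biprodUnopIso]

lemma biprodUnopIso_hom_map {A A' B B' : Cᵒᵖ} (f : A ⟶ B) (f' : A' ⟶ B') :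
    biprod.map f.unop f'.unop ≫ (biprodUnopIso A A').hom =
      (biprodUnopIso B B').hom ≫ (biprod.map f f').unop := by
  ext <;> simp [← unop_comp, reassoc_of% (inl_biprodUnopIso_hom B B'),
    reassoc_of% (inr_biprodUnopIso_hom B B')]

end Opposite

/-! ### Exactness properties, isomorphism invariance and base change of triangles -/

namespace Extriangulated

variable {C : Type u} [Category.{v} C] [Preadditive C] [HasZeroObject C] [HasBinaryBiproducts C]
variable (S : Extriangulated.{w} C)

lemma sub_push {Z A A' : C} (a a' : A ⟶ A') (δ : Ext S.E Z A) :
    push S.E (a - a') δ = push S.E a δ - push S.E a' δ := by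
  have := S.additive_right (op Z)
  simp [push, Functor.map_sub, AddCommGrpCat.hom_sub]

lemma sub_pull {Z Z' A : C} (c c' : Z' ⟶ Z) (δ : Ext S.E Z A) :
    pull S.E (c - c') δ = pull S.E c δ - pull S.E c' δ := by
  have := S.additive_left
  simp [pull, Functor.map_sub, AddCommGrpCat.hom_sub]

@[simp]
lemma zero_push {Z A A' : C} (δ : Ext S.E Z A) : push S.E (0 : A ⟶ A') δ = 0 := by
  simpa using S.sub_push (0 : A ⟶ A') 0 δ

variable {S}

/-- The sequence `A ⟶ A ⟶ 0` is a triangle. -/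
lemma triangle_id_zero {O : C} (hO : IsZero O) (A : C) :
    S.IsTriangle (𝟙 A) (0 : A ⟶ O) (0 : Ext S.E O A) :=
  S.triangle_of_equivalent (S.triangle_zero A O)
    ⟨biprod.fst, biprod.inl, by ext <;> simp [hO.eq_of_src _ (0 : O ⟶ _)], by simp⟩
    (by simp) (hO.eq_of_tgt _ _)

/-- The sequence `0 ⟶ Z ⟶ Z` is a triangle. -/
lemma triangle_zero_id {O : C} (hO : IsZero O) (Z : C) :
    S.IsTriangle (0 : O ⟶ Z) (𝟙 Z) (0 : Ext S.E Z O) :=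
  S.triangle_of_equivalent (S.triangle_zero O Z)
    ⟨biprod.snd, biprod.inr, by ext <;> simp [hO.eq_of_src _ (0 : O ⟶ _)], by simp⟩
    (hO.eq_of_src _ _) (by simp)

/-- The sequence `A ⟶ Z ⊞ A ⟶ Z` is a triangle. -/
lemma triangle_inr_fst (A Z : C) :
    S.IsTriangle (biprod.inr : A ⟶ Z ⊞ A) (biprod.fst : Z ⊞ A ⟶ Z) (0 : Ext S.E Z A) :=
  S.triangle_of_equivalent (S.triangle_zero A Z) (biprod.braiding _ _)
    (by ext <;> simp) (by simp)

section Triangle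

variable {A B Z : C} {x : A ⟶ B} {y : B ⟶ Z} {δ : Ext S.E Z A}

/-- Comparison with the trivial triangles `A ⟶ A ⟶ 0` and `0 ⟶ Z ⟶ Z`, through (ET3), (ET3)ᵒᵖ or
`realize_hom`, yields this and the following exactness properties of `Hom` and `𝔼`. -/
lemma IsTriangle.comp_zero (h : S.IsTriangle x y δ) : x ≫ y = 0 := by
  obtain ⟨c, hc, -⟩ := S.et3 (triangle_id_zero (isZero_zero C) A) h (𝟙 A) x (by simp)
  simpa using hc.symm

lemma IsTriangle.pull_eq_zero (h : S.IsTriangle x y δ) : pull S.E y δ = 0 := by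
  obtain ⟨a, -, ha⟩ := S.et3_op (triangle_zero_id (isZero_zero C) B) h (𝟙 B) y (by simp)
  simpa using ha.symm

lemma IsTriangle.push_eq_zero (h : S.IsTriangle x y δ) : push S.E x δ = 0 := by
  obtain ⟨c, -, hc⟩ := S.et3 h (triangle_id_zero (isZero_zero C) B) x (𝟙 B) (by simp)
  simpa using hc

lemma IsTriangle.exists_lift (h : S.IsTriangle x y δ) {W : C} (b : W ⟶ B) (hb : b ≫ y = 0) :
    ∃ a : W ⟶ A, a ≫ x = b := by
  obtain ⟨a, ha, -⟩ := S.et3_op (triangle_id_zero (isZero_zero C) W) h b 0 (by simp [hb])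
  exact ⟨a, by simpa using ha.symm⟩

lemma IsTriangle.exists_desc (h : S.IsTriangle x y δ) {W : C} (b : B ⟶ W) (hb : x ≫ b = 0) :
    ∃ c : Z ⟶ W, y ≫ c = b := by
  obtain ⟨c, hc, -⟩ := S.et3 h (triangle_zero_id (isZero_zero C) W) 0 b (by simp [hb])
  exact ⟨c, by simpa using hc⟩

lemma IsTriangle.exists_lift_of_pull_eq_zero (h : S.IsTriangle x y δ) {W : C} (c : W ⟶ Z)
    (hc : pull S.E c δ = 0) : ∃ b : W ⟶ B, b ≫ y = c := by
  obtain ⟨b, -, hb⟩ := S.realize_hom (triangle_zero_id (isZero_zero C) W) h 0 c (by simp [hc])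
  exact ⟨b, by simpa using hb.symm⟩

lemma IsTriangle.exists_desc_of_push_eq_zero (h : S.IsTriangle x y δ) {W : C} (a : A ⟶ W)
    (ha : push S.E a δ = 0) : ∃ b : B ⟶ W, x ≫ b = a := by
  obtain ⟨b, hb, -⟩ := S.realize_hom h (triangle_id_zero (isZero_zero C) W) a 0 (by simp [ha])
  exact ⟨b, by simpa using hb⟩

/-- Realize `ε` by `A ⟶ G ⟶ W`. As `x_* ε = 0`, the map `x` extends to `G`, and (ET3) with the
identity on `A` supplies `c`. -/
lemma IsTriangle.exists_pull_eq (h : S.IsTriangle x y δ) {W : C} (ε : Ext S.E W A)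
    (hε : push S.E x ε = 0) : ∃ c : W ⟶ Z, pull S.E c δ = ε := by
  obtain ⟨G, g, g', hg⟩ := S.exists_triangle ε
  obtain ⟨b, hb⟩ := hg.exists_desc_of_push_eq_zero x hε
  obtain ⟨c, -, hc⟩ := S.et3 hg h (𝟙 A) b (by simp [hb])
  exact ⟨c, by simpa using hc.symm⟩

/-- Triangles are stable under isomorphisms of sequences. -/
lemma IsTriangle.of_iso (h : S.IsTriangle x y δ) {A' B' Z' : C} {x' : A' ⟶ B'} {y' : B' ⟶ Z'}
    (i : A ≅ A') (j : B ≅ B') (k : Z ≅ Z') (hx : x ≫ j.hom = i.hom ≫ x')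
    (hy : y ≫ k.hom = j.hom ≫ y') :
    S.IsTriangle x' y' (push S.E i.hom (pull S.E k.inv δ)) := by
  obtain ⟨B'', x'', y'', h''⟩ := S.exists_triangle (push S.E i.hom (pull S.E k.inv δ))
  obtain ⟨b, hb, hb'⟩ := S.realize_hom h h'' i.hom k.hom (by
    rw [pull_push, ← pull_comp]; simp)
  -- To invert `b`: `s` is a right-sided candidate whose error `𝟙 - s ≫ b` is killed by `y''`, hence
  -- is corrected through `x''`. Dually `s'` is corrected through `y`. The two one-sided inverses
  -- then agree.
  obtain ⟨s, hs⟩ := h.exists_lift_of_pull_eq_zero (y'' ≫ k.inv) (by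
    have := congrArg (push S.E i.inv) h''.pull_eq_zero
    rw [pull_push, ← push_comp] at this
    simpa [pull_comp] using this)
  obtain ⟨t, ht⟩ := h''.exists_lift (𝟙 _ - s ≫ b) (by
    simp [← hb', reassoc_of% hs])
  obtain ⟨s', hs'⟩ := h''.exists_desc_of_push_eq_zero (i.inv ≫ x) (by
    rw [← push_comp, i.hom_inv_id_assoc, ← pull_push, h.push_eq_zero, pull_zero])
  obtain ⟨t', ht'⟩ := h.exists_desc (𝟙 _ - b ≫ s') (by
    simp [reassoc_of% hb, hs'])
  have h1 : (s + t ≫ i.inv ≫ x) ≫ b = 𝟙 _ := by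
    simp [hb, ht]
  have h2 : b ≫ (s' + y'' ≫ k.inv ≫ t') = 𝟙 _ := by
    simp [← reassoc_of% hb', ht']
  have h3 : s + t ≫ i.inv ≫ x = s' + y'' ≫ k.inv ≫ t' := by
    simpa [reassoc_of% h1] using (congrArg ((s + t ≫ i.inv ≫ x) ≫ ·) h2).symm
  let e : B ≅ B'' := ⟨b, s + t ≫ i.inv ≫ x, h3 ▸ h2, h1⟩
  refine S.triangle_of_equivalent h'' (e.symm ≪≫ j) ?_ ?_
  · have : x'' = i.inv ≫ x ≫ e.hom := by simp [e, hb]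
    simp [this, hx]
  · have : e.hom ≫ y'' = j.hom ≫ y' := by simp [e, ← hb', hy]
    simp [← this]

end Triangle

/-- Conflations are stable under isomorphisms of sequences. -/
lemma IsConflation.of_iso {A B Z : C} {x : A ⟶ B} {y : B ⟶ Z} (h : S.IsConflation x y)
    {A' B' Z' : C} {x' : A' ⟶ B'} {y' : B' ⟶ Z'}
    (i : A ≅ A') (j : B ≅ B') (k : Z ≅ Z') (hx : x ≫ j.hom = i.hom ≫ x')
    (hy : y ≫ k.hom = j.hom ≫ y') : S.IsConflation x' y' :=
  let ⟨_, hδ⟩ := h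
  ⟨_, hδ.of_iso i j k hx hy⟩

/-- If `p` is a deflation, so is `(g, p)`. -/
lemma IsDeflation.desc {B B' Z : C} {p : B' ⟶ Z} (hp : S.IsDeflation p) (g : B ⟶ Z) :
    S.IsDeflation (biprod.desc g p) := by
  obtain ⟨K, k, ρ, hρ⟩ := hp
  -- `(g, p)` is the composite of the deflation `𝟙 ⊕ p` with the split deflation `(g, 𝟙)`, so
  -- (ET4)ᵒᵖ applies.
  have h1 := S.triangle_sum (triangle_zero_id (isZero_zero C) B) hρ
  have h2 : S.IsTriangle (biprod.lift (𝟙 B) (-g)) (biprod.desc g (𝟙 Z)) 0 :=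
    S.triangle_of_equivalent (S.triangle_zero B Z)
      ⟨biprod.lift biprod.fst (biprod.snd - biprod.fst ≫ g),
        biprod.lift biprod.fst (biprod.snd + biprod.fst ≫ g), by ext <;> simp, by ext <;> simp⟩
      (by ext <;> simp) (by ext <;> simp)
  obtain ⟨X, h', h, -, -, δ, hh, -, -, hX, -⟩ := S.et4_op h1 h2
  refine ⟨X, h', δ, ?_⟩
  convert hX
  rw [← hh]
  ext <;> simp

/-- Base change of a triangle along a deflation. -/
lemma exists_base_change {A B K P Z : C} {x : A ⟶ B} {y : B ⟶ Z} (h : S.IsConflation x y)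
    {k : K ⟶ P} {p : P ⟶ Z} (hp : S.IsConflation k p) :
    ∃ (W : C) (m₁ : A ⟶ W) (e₁ : W ⟶ B) (m₂ : K ⟶ W) (e₂ : W ⟶ P),
      S.IsConflation m₁ e₂ ∧ S.IsConflation m₂ e₁ ∧ m₁ ≫ e₁ = x ∧ m₂ ≫ e₂ = k := by
  obtain ⟨δ, hδ⟩ := h
  obtain ⟨ρ, hρ⟩ := hp
  -- `W` is the middle term of the extension `(δ, ρ)` of `Z` by `A ⊞ K`. Dividing out `K` or `A` by
  -- (ET4) leaves an extension with class `δ` or `ρ`, hence `B` or `P` by uniqueness of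
  -- realizations.
  obtain ⟨W, j, j', hW⟩ := S.exists_triangle
    (push S.E (biprod.inl : A ⟶ A ⊞ K) δ + push S.E (biprod.inr : K ⟶ A ⊞ K) ρ)
  obtain ⟨X₁, h₁, h₁', d₁, e₁, δ₁, r₁, s₁, t₁, T₁, U₁, -⟩ := S.et4 (triangle_inr_fst K A) hW
  obtain ⟨X₂, h₂, h₂', d₂, e₂, δ₂, r₂, s₂, t₂, T₂, U₂, -⟩ := S.et4 (S.triangle_zero A K) hW
  rw [push_add, ← push_comp, ← push_comp] at U₁ U₂
  simp only [biprod.inl_fst, biprod.inr_fst, biprod.inl_snd, biprod.inr_snd, zero_push, push_id,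
    add_zero, zero_add] at U₁ U₂
  obtain ⟨b₁, hb₁, hb₁'⟩ := S.triangle_unique U₁ hδ
  obtain ⟨b₂, hb₂, hb₂'⟩ := S.triangle_unique U₂ hρ
  refine ⟨W, h₂, h₁' ≫ b₁.hom, h₁, h₂' ≫ b₂.hom,
    IsConflation.of_iso ⟨_, T₂⟩ (Iso.refl _) (Iso.refl _) b₂ (by simp) (by simp),
    IsConflation.of_iso ⟨_, T₁⟩ (Iso.refl _) (Iso.refl _) b₁ (by simp) (by simp), ?_, ?_⟩
  · rw [← r₂, Category.assoc, ← reassoc_of% s₁, hb₁, biprod.inl_fst_assoc]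
  · rw [← r₁, Category.assoc, ← reassoc_of% s₂, hb₂, biprod.inr_snd_assoc]

/-- A triangle ending in a projective splits, and pulling its class back along its own deflation
gives zero. -/
lemma projectives_iff {P : C} :
    S.projectives P ↔ ∀ (A : C) (δ : Ext S.E P A), δ = 0 := by
  refine ⟨fun hP A δ => ?_, fun hP B Z y ⟨A, x, δ, h⟩ c =>
    h.exists_lift_of_pull_eq_zero c (hP _ _)⟩
  obtain ⟨B, x, y, h⟩ := S.exists_triangle δ
  obtain ⟨b, hb⟩ := hP y ⟨A, x, δ, h⟩ (𝟙 P)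
  rw [← pull_id S.E δ, ← hb, pull_comp, h.pull_eq_zero, pull_zero]

lemma projectives_of_isZero {O : C} (hO : IsZero O) : S.projectives O :=
  fun _ _ _ _ _ => ⟨0, hO.eq_of_src _ _⟩

/-! ### The opposite extriangulated category -/

/-- The bifunctor `(Z, A) ↦ 𝔼(A, Z)` on the opposite category. -/
abbrev opE (S : Extriangulated.{w} C) : Cᵒᵖᵒᵖ ⥤ Cᵒᵖ ⥤ AddCommGrpCat.{w} :=
  unopUnop C ⋙ S.E.flip

lemma opE_push {Z A A' : Cᵒᵖ} (a : A ⟶ A') (δ : Ext S.opE Z A) :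
    push S.opE a δ = pull S.E a.unop (show Ext S.E A.unop Z.unop from δ) := rfl

lemma opE_pull {Z Z' A : Cᵒᵖ} (c : Z' ⟶ Z) (δ : Ext S.opE Z A) :
    pull S.opE c δ = push S.E c.unop (show Ext S.E A.unop Z.unop from δ) := rfl

variable (S) in
/-- The extriangulated structure on the opposite category. -/
def opposite : Extriangulated.{w} Cᵒᵖ where
  E := S.opE
  additive_left := by
    have := S.additive_right
    exact ⟨fun {X Y f g} => by ext Z : 2; exact (S.E.obj Z).map_add⟩
  additive_right Z := by
    have := S.additive_left
    exact ⟨fun {X Y f g} => by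
      change (S.E.map (f + g)).app _ = _
      rw [S.E.map_add]; rfl⟩
  IsTriangle {A B Z} x y δ := S.IsTriangle (A := Z.unop) (B := B.unop) (Z := A.unop) y.unop x.unop δ
  exists_triangle {A Z} δ :=
    let ⟨B, x, y, h⟩ := S.exists_triangle (A := Z.unop) (Z := A.unop) δ
    ⟨op B, y.op, x.op, h⟩
  triangle_of_equivalent h b h1 h2 :=
    S.triangle_of_equivalent h b.unop.symm
      (by rw [← h2, unop_comp, Category.assoc, Iso.symm_hom, Iso.unop_inv, ← unop_comp]; simp)
      (by rw [← h1, unop_comp, Iso.symm_hom, Iso.unop_inv, ← Category.assoc, ← unop_comp]; simp)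
  triangle_unique h h' :=
    let ⟨b, h1, h2⟩ := S.triangle_unique h h'
    ⟨b.symm.op, Quiver.Hom.unop_inj ((Iso.inv_comp_eq b).2 h2.symm),
      Quiver.Hom.unop_inj ((Iso.comp_inv_eq b).2 h1.symm)⟩
  realize_hom h h' a c hac :=
    let ⟨b, h1, h2⟩ := S.realize_hom h' h c.unop a.unop hac.symm
    ⟨b.op, Quiver.Hom.unop_inj h2.symm, Quiver.Hom.unop_inj h1.symm⟩
  triangle_zero A Z := S.triangle_of_equivalent (triangle_inr_fst Z.unop A.unop)
    (biprodUnopIso A Z) (by simp) (by simp)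
  triangle_sum h h' := by
    -- The sum triangle of `C` is carried to the biproducts of `Cᵒᵖ` by `biprodUnopIso`; it remains
    -- to match the extension classes.
    convert (S.triangle_sum h h').of_iso (biprodUnopIso _ _) (biprodUnopIso _ _)
      (biprodUnopIso _ _) (biprodUnopIso_hom_map _ _) (biprodUnopIso_hom_map _ _) using 1
    simp only [extSum, opE_push, opE_pull, push_add, pull_add, ← pull_push, ← push_comp,
      ← pull_comp, inl_biprodUnopIso_hom, inr_biprodUnopIso_hom, biprodUnopIso_inv_fst,
      biprodUnopIso_inv_snd]
  et3 h h' a b hab :=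
    let ⟨c, h1, h2⟩ := S.et3_op h' h b.unop a.unop (congrArg Quiver.Hom.unop hab).symm
    ⟨c.op, Quiver.Hom.unop_inj h1.symm, h2.symm⟩
  et3_op h h' b c hbc :=
    let ⟨a, h1, h2⟩ := S.et3 h' h c.unop b.unop (congrArg Quiver.Hom.unop hbc).symm
    ⟨a.op, Quiver.Hom.unop_inj h1.symm, h2.symm⟩
  et4 h h' :=
    let ⟨X, h', h, d, e, δ, a1, a2, a3, a4, a5, a6, a7⟩ := S.et4_op h' h
    ⟨op X, h.op, h'.op, e.op, d.op, δ, Quiver.Hom.unop_inj a1,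
      Quiver.Hom.unop_inj a3.symm, Quiver.Hom.unop_inj a2, a4, a5, a6, a7.symm⟩
  et4_op h h' :=
    let ⟨X, h', h, d, e, δ, a1, a2, a3, a4, a5, a6, a7⟩ := S.et4 h' h
    ⟨op X, h.op, h'.op, e.op, d.op, δ, Quiver.Hom.unop_inj a1,
      Quiver.Hom.unop_inj a3, Quiver.Hom.unop_inj a2.symm, a4, a5, a6, a7.symm⟩

end Extriangulated

/-! ### Finitely presented modules as cokernels of morphisms of representable functors -/

section Cokernel

variable {A : Type u} [Category.{v} A] [Preadditive A]

/-- The cokernel of `A(-, X) ⟶ A(-, Y)`. -/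
noncomputable abbrev coyon {X Y : A} (f : X ⟶ Y) : Aᵒᵖ ⥤ AddCommGrpCat.{v} :=
  cokernel (preadditiveYoneda.map f)

/-- The projection `A(-, Y) ⟶ coyon f`. -/
noncomputable abbrev coyonπ {X Y : A} (f : X ⟶ Y) : preadditiveYoneda.obj Y ⟶ coyon f :=
  cokernel.π (preadditiveYoneda.map f)

lemma coyonπ_exact {X Y : A} (f : X ⟶ Y) (Z : Aᵒᵖ) :
    Function.Exact ((preadditiveYoneda.map f).app Z).hom ((coyonπ f).app Z).hom ∧
      Function.Surjective ((coyonπ f).app Z).hom := by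
  constructor
  · have := (ShortComplex.exact_cokernel (preadditiveYoneda.map f)).map
      ((evaluation Aᵒᵖ AddCommGrpCat.{v}).obj Z)
    exact (ShortComplex.ab_exact_iff_function_exact _).1 this
  · exact (AddCommGrpCat.epi_iff_surjective _).1 inferInstance

lemma additive_of_surjective {F G : Aᵒᵖ ⥤ AddCommGrpCat.{v}} [F.Additive] (p : F ⟶ G)
    (hp : ∀ Z, Function.Surjective (p.app Z).hom) : G.Additive where
  map_add {X Y f g} := by
    have : Epi (p.app X) := (AddCommGrpCat.epi_iff_surjective _).2 (hp X)
    rw [← cancel_epi (p.app X)]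
    simp [← NatTrans.naturality, F.map_add, Preadditive.add_comp]

lemma isFinitelyPresentedModule_coyon {X Y : A} (f : X ⟶ Y) :
    IsFinitelyPresentedModule A (coyon f) :=
  ⟨additive_of_surjective (coyonπ f) fun Z => (coyonπ_exact f Z).2, X, Y, _, coyonπ f,
    coyonπ_exact f⟩

/-- Every finitely presented module is the cokernel of a morphism between representables. -/
lemma IsFinitelyPresentedModule.exists_iso {F : Aᵒᵖ ⥤ AddCommGrpCat.{v}}
    (hF : IsFinitelyPresentedModule A F) :
    ∃ (X Y : A) (f : X ⟶ Y), Nonempty (coyon f ≅ F) := by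
  obtain ⟨-, X, Y, f, p, h⟩ := hF
  obtain ⟨f, rfl⟩ := preadditiveYoneda.map_surjective f
  have hfp : preadditiveYoneda.map f ≫ p = 0 := by
    ext Z z
    exact (h Z).1.apply_apply_eq_zero z
  let q : coyon f ⟶ F := cokernel.desc _ p hfp
  have hq : ∀ Z, ((coyonπ f).app Z) ≫ q.app Z = p.app Z := fun Z => by
    rw [← NatTrans.comp_app, cokernel.π_desc]
  have : ∀ Z, IsIso (q.app Z) := fun Z => by
    rw [ConcreteCategory.isIso_iff_bijective]
    constructor
    · rw [injective_iff_map_eq_zero]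
      intro t ht
      obtain ⟨s, rfl⟩ := (coyonπ_exact f Z).2 t
      have hs := ConcreteCategory.congr_hom (hq Z) s
      obtain ⟨r, rfl⟩ := ((h Z).1 s).1 (hs.symm.trans ht)
      exact (coyonπ_exact f Z).1.apply_apply_eq_zero r
    · intro t
      obtain ⟨s, rfl⟩ := (h Z).2 t
      exact ⟨(coyonπ f).app Z s, ConcreteCategory.congr_hom (hq Z) s⟩
  have : IsIso q := NatIso.isIso_of_isIso_app q
  exact ⟨X, Y, f, ⟨asIso q⟩⟩

/-- By Yoneda the composite corresponds to the class of `b` in the cokernel evaluated at `W`. -/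
lemma map_comp_coyonπ_eq_zero_iff {X Y W : A} (f : X ⟶ Y) (b : W ⟶ Y) :
    preadditiveYoneda.map b ≫ coyonπ f = 0 ↔ ∃ s, s ≫ f = b := by
  constructor
  · intro h
    have h' : ((coyonπ f).app (op W)).hom (𝟙 W ≫ b) = 0 :=
      ConcreteCategory.congr_hom (NatTrans.congr_app h (op W)) (𝟙 W)
    rw [Category.id_comp] at h'
    obtain ⟨s, hs⟩ := ((coyonπ_exact f (op W)).1 b).1 h'
    exact ⟨s, hs⟩
  · rintro ⟨s, rfl⟩
    simp

/-- Projectivity of representables: lift the element of `coyon f` at `W` that corresponds to `u`. -/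
lemma exists_map_comp_coyonπ {X Y W : A} (f : X ⟶ Y) (u : preadditiveYoneda.obj W ⟶ coyon f) :
    ∃ b : W ⟶ Y, preadditiveYoneda.map b ≫ coyonπ f = u := by
  obtain ⟨b, hb⟩ := (coyonπ_exact f (op W)).2 ((u.app (op W)).hom (𝟙 W))
  refine ⟨b, ?_⟩
  ext Z z
  have h1 : (u.app Z).hom (z ≫ 𝟙 W) = ((coyon f).map (Quiver.Hom.op z)).hom
      ((u.app (op W)).hom (𝟙 W)) :=
    ConcreteCategory.congr_hom (u.naturality (Quiver.Hom.op z)) (𝟙 W)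
  have h2 : ((coyonπ f).app Z).hom (z ≫ b) = ((coyon f).map (Quiver.Hom.op z)).hom
      (((coyonπ f).app (op W)).hom b) :=
    ConcreteCategory.congr_hom ((coyonπ f).naturality (Quiver.Hom.op z)) b
  exact h2.trans ((congrArg _ hb).trans (h1.symm.trans
    (congrArg (u.app Z).hom (Category.comp_id (show unop Z ⟶ W from z)))))

/-- The morphism of cokernels induced by a morphism `b` of targets which fits into a
commutative square. -/
noncomputable def coyonMap {X Y X' Y' : A} {f : X ⟶ Y} {f' : X' ⟶ Y'} (b : Y ⟶ Y')
    (hb : ∃ a : X ⟶ X', a ≫ f' = f ≫ b) : coyon f ⟶ coyon f' :=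
  cokernel.desc _ (preadditiveYoneda.map b ≫ coyonπ f') (by
    rw [← Category.assoc, ← Functor.map_comp, map_comp_coyonπ_eq_zero_iff]
    exact hb)

section

variable {X Y X' Y' : A} {f : X ⟶ Y} {f' : X' ⟶ Y'}

lemma coyonπ_coyonMap (b : Y ⟶ Y') (hb : ∃ a : X ⟶ X', a ≫ f' = f ≫ b) :
    coyonπ f ≫ coyonMap b hb = preadditiveYoneda.map b ≫ coyonπ f' :=
  cokernel.π_desc _ _ _

/-- Together with `coyonMap_surjective`, this describes maps of finitely presented modules as
squares modulo homotopy; the component on sources only has to exist. -/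
lemma coyonMap_eq_iff {b b' : Y ⟶ Y'} (hb : ∃ a : X ⟶ X', a ≫ f' = f ≫ b)
    (hb' : ∃ a : X ⟶ X', a ≫ f' = f ≫ b') :
    coyonMap b hb = coyonMap b' hb' ↔ ∃ s : Y ⟶ X', s ≫ f' = b - b' := by
  rw [← map_comp_coyonπ_eq_zero_iff, ← cancel_epi (coyonπ f), coyonπ_coyonMap,
    coyonπ_coyonMap, ← sub_eq_zero, ← Preadditive.sub_comp]
  congr! 3
  ext Z z
  exact (Preadditive.comp_sub (show unop Z ⟶ Y from z) b b').symm

lemma coyonMap_surjective (u : coyon f ⟶ coyon f') :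
    ∃ (b : Y ⟶ Y') (hb : ∃ a : X ⟶ X', a ≫ f' = f ≫ b), coyonMap b hb = u := by
  obtain ⟨b, hb⟩ := exists_map_comp_coyonπ f' (coyonπ f ≫ u)
  refine ⟨b, ?_, ?_⟩
  · rw [← map_comp_coyonπ_eq_zero_iff, Functor.map_comp, Category.assoc, hb]
    simp
  · rw [← cancel_epi (coyonπ f), coyonπ_coyonMap, hb]

lemma coyonMap_comp {X'' Y'' : A} {f'' : X'' ⟶ Y''} (b : Y ⟶ Y') (b' : Y' ⟶ Y'')
    (hb : ∃ a : X ⟶ X', a ≫ f' = f ≫ b) (hb' : ∃ a : X' ⟶ X'', a ≫ f'' = f' ≫ b')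
    (hbb' : ∃ a : X ⟶ X'', a ≫ f'' = f ≫ b ≫ b') :
    coyonMap b hb ≫ coyonMap b' hb' = coyonMap (b ≫ b') hbb' := by
  rw [← cancel_epi (coyonπ f), ← Category.assoc, coyonπ_coyonMap, Category.assoc,
    coyonπ_coyonMap, coyonπ_coyonMap, Functor.map_comp, Category.assoc]

lemma coyonMap_id (h : ∃ a : X ⟶ X, a ≫ f = f ≫ 𝟙 Y) : coyonMap (𝟙 Y) h = 𝟙 (coyon f) := by
  rw [← cancel_epi (coyonπ f), coyonπ_coyonMap]
  simp

end

/-- Isomorphic morphisms have isomorphic cokernels. -/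
noncomputable def coyonIso {f g : Arrow A} (e : f ≅ g) :
    coyon f.hom ≅ coyon g.hom where
  hom := coyonMap e.hom.right ⟨e.hom.left, e.hom.w⟩
  inv := coyonMap e.inv.right ⟨e.inv.left, e.inv.w⟩
  hom_inv_id := by
    rw [coyonMap_comp _ _ _ _ ⟨𝟙 _, by simp⟩]
    simp [coyonMap_id]
  inv_hom_id := by
    rw [coyonMap_comp _ _ _ _ ⟨𝟙 _, by simp⟩]
    simp [coyonMap_id]

end Cokernel

/-! ### Presentations of a category by morphisms of an additive category -/

/-- A presentation of the objects of `N` by morphisms of `A`. Every object of `N` has resolutions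
`ρ`, with an underlying morphism `d ρ` of `A`, and morphisms of `N` are related to morphisms
between the targets of the `d ρ`; two morphisms of `N` are identified by `r` if and only if the
related morphisms are homotopic. -/
structure Presentation {N : Type*} [Category* N] (r : HomRel N) (A : Type u) [Category.{v} A]
    [Preadditive A] where
  Res : N → Type*
  d : ∀ {X : N}, Res X → Arrow A
  Rel : ∀ {X X' : N} (ρ : Res X) (ρ' : Res X'), (X ⟶ X') → ((d ρ).right ⟶ (d ρ').right) → Prop
  nonempty : ∀ X, Nonempty (Res X)
  rel_square : ∀ {X X' : N} {ρ : Res X} {ρ' : Res X'} {φ : X ⟶ X'}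
    {b : (d ρ).right ⟶ (d ρ').right}, Rel ρ ρ' φ b →
      ∃ a : (d ρ).left ⟶ (d ρ').left, a ≫ (d ρ').hom = (d ρ).hom ≫ b
  exists_rel : ∀ {X X' : N} (ρ : Res X) (ρ' : Res X') (φ : X ⟶ X'), ∃ b, Rel ρ ρ' φ b
  rel_id : ∀ {X : N} (ρ : Res X), Rel ρ ρ (𝟙 X) (𝟙 _)
  rel_comp : ∀ {X X' X'' : N} {ρ : Res X} {ρ' : Res X'} {ρ'' : Res X''} {φ : X ⟶ X'}
    {φ' : X' ⟶ X''} {b : (d ρ).right ⟶ (d ρ').right} {b' : (d ρ').right ⟶ (d ρ'').right},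
    Rel ρ ρ' φ b → Rel ρ' ρ'' φ' b' → Rel ρ ρ'' (φ ≫ φ') (b ≫ b')
  rel_iff : ∀ {X X' : N} {ρ : Res X} {ρ' : Res X'} {φ φ' : X ⟶ X'}
    {b b' : (d ρ).right ⟶ (d ρ').right}, Rel ρ ρ' φ b → Rel ρ ρ' φ' b' →
      (r φ φ' ↔ ∃ s : (d ρ).right ⟶ (d ρ').left, s ≫ (d ρ').hom = b - b')
  exists_hom : ∀ {X X' : N} (ρ : Res X) (ρ' : Res X') (a : (d ρ).left ⟶ (d ρ').left)
    (b : (d ρ).right ⟶ (d ρ').right), a ≫ (d ρ').hom = (d ρ).hom ≫ b → ∃ φ, Rel ρ ρ' φ b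
  exists_res : ∀ f : Arrow A, ∃ (X : N) (ρ : Res X), Nonempty (d ρ ≅ f)

namespace Presentation

variable {N : Type*} [Category* N] {r : HomRel N} {A : Type u} [Category.{v} A] [Preadditive A]
  (R : Presentation r A)

/-- A choice of resolution. -/
noncomputable def res (X : N) : R.Res X := (R.nonempty X).some

/-- A choice of a morphism related to `φ`. -/
noncomputable def map {X X' : N} (ρ : R.Res X) (ρ' : R.Res X') (φ : X ⟶ X') :
    (R.d ρ).right ⟶ (R.d ρ').right := (R.exists_rel ρ ρ' φ).choose

lemma map_rel {X X' : N} (ρ : R.Res X) (ρ' : R.Res X') (φ : X ⟶ X') :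
    R.Rel ρ ρ' φ (R.map ρ ρ' φ) := (R.exists_rel ρ ρ' φ).choose_spec

/-- The morphism of modules induced by `φ`. -/
noncomputable def modMap {X X' : N} (ρ : R.Res X) (ρ' : R.Res X') (φ : X ⟶ X') :
    coyon (R.d ρ).hom ⟶ coyon (R.d ρ').hom :=
  coyonMap (R.map ρ ρ' φ) (R.rel_square (R.map_rel ρ ρ' φ))

lemma modMap_eq_iff {X X' : N} (ρ : R.Res X) (ρ' : R.Res X') (φ φ' : X ⟶ X') :
    R.modMap ρ ρ' φ = R.modMap ρ ρ' φ' ↔ r φ φ' :=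
  (coyonMap_eq_iff _ _).trans (R.rel_iff (R.map_rel ρ ρ' φ) (R.map_rel ρ ρ' φ')).symm

variable [Congruence r]

lemma coyonMap_eq_modMap {X X' : N} {ρ : R.Res X} {ρ' : R.Res X'} {φ : X ⟶ X'}
    {b : (R.d ρ).right ⟶ (R.d ρ').right} (h : R.Rel ρ ρ' φ b) :
    coyonMap b (R.rel_square h) = R.modMap ρ ρ' φ :=
  (coyonMap_eq_iff _ _).2 ((R.rel_iff h (R.map_rel ρ ρ' φ)).1 (Congruence.equivalence.refl φ))

lemma modMap_comp {X X' X'' : N} (ρ : R.Res X) (ρ' : R.Res X') (ρ'' : R.Res X'') (φ : X ⟶ X')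
    (φ' : X' ⟶ X'') : R.modMap ρ ρ'' (φ ≫ φ') = R.modMap ρ ρ' φ ≫ R.modMap ρ' ρ'' φ' := by
  have h := R.rel_comp (R.map_rel ρ ρ' φ) (R.map_rel ρ' ρ'' φ')
  rw [← R.coyonMap_eq_modMap h]
  exact (coyonMap_comp _ _ _ _ _).symm

lemma modMap_id {X : N} (ρ : R.Res X) : R.modMap ρ ρ (𝟙 X) = 𝟙 _ := by
  rw [← R.coyonMap_eq_modMap (R.rel_id ρ)]
  exact coyonMap_id _

/-- The functor to finitely presented modules given by a presentation. -/
noncomputable def functor : N ⥤ FpMod A where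
  obj X := ⟨coyon (R.d (R.res X)).hom, isFinitelyPresentedModule_coyon _⟩
  map φ := ObjectProperty.homMk (R.modMap _ _ φ)
  map_id X := by ext1; exact R.modMap_id _
  map_comp φ φ' := by ext1; exact R.modMap_comp _ _ _ φ φ'

lemma functor_map_eq_iff {X X' : N} (φ φ' : X ⟶ X') :
    R.functor.map φ = R.functor.map φ' ↔ r φ φ' := by
  rw [← R.modMap_eq_iff (R.res X) (R.res X')]
  exact ⟨fun h => congrArg (·.hom) h, fun h => by ext1; exact h⟩

instance : R.functor.Full where
  map_surjective {X X'} u := by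
    obtain ⟨b, ⟨a, hab⟩, hb⟩ := coyonMap_surjective u.hom
    obtain ⟨φ, hφ⟩ := R.exists_hom _ _ a b hab
    exact ⟨φ, by ext1; exact (R.coyonMap_eq_modMap hφ).symm.trans hb⟩

instance : R.functor.EssSurj where
  mem_essImage F := by
    obtain ⟨X, Y, f, ⟨e⟩⟩ := F.property.exists_iso
    obtain ⟨X, ρ, ⟨e'⟩⟩ := R.exists_res (Arrow.mk f)
    -- The chosen resolution of `X` may differ from `ρ`; the identity of `X` compares their
    -- cokernels.
    let i : coyon (R.d (R.res X)).hom ≅ coyon (R.d ρ).hom :=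
      ⟨R.modMap _ _ (𝟙 X), R.modMap _ _ (𝟙 X), by simp [← modMap_comp, modMap_id],
        by simp [← modMap_comp, modMap_id]⟩
    exact ⟨X, ⟨ObjectProperty.isoMk _ (i ≪≫ coyonIso e' ≪≫ e)⟩⟩

end Presentation

/-! ### Equivalences out of a quotient category -/

section Quotient

variable {N B : Type*} [Category* N] [Category* B] (r : HomRel N) (F : N ⥤ B) [F.Full] [F.EssSurj]

/-- A full and essentially surjective functor induces an equivalence from the quotient by the
relation of having the same image. -/
lemma isEquivalence_quotient_lift
    (hF : ∀ {X Y : N} (f g : X ⟶ Y), F.map f = F.map g ↔ r f g) :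
    (CategoryTheory.Quotient.lift r F fun _ _ f g h => (hF f g).2 h).IsEquivalence where
  full := ⟨fun {X Y} u => by
    obtain ⟨f, rfl⟩ := F.map_surjective u
    exact ⟨(CategoryTheory.Quotient.functor r).map f, rfl⟩⟩
  faithful := ⟨fun {X Y} u v h => by
    obtain ⟨f, rfl⟩ := (CategoryTheory.Quotient.functor r).map_surjective u
    obtain ⟨g, rfl⟩ := (CategoryTheory.Quotient.functor r).map_surjective v
    exact CategoryTheory.Quotient.sound r ((hF f g).1 h)⟩
  essSurj := ⟨fun Y => ⟨⟨F.objPreimage Y⟩, ⟨F.objObjPreimageIso Y⟩⟩⟩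

lemma nonempty_quotient_equivalence
    (hF : ∀ {X Y : N} (f g : X ⟶ Y), F.map f = F.map g ↔ r f g) :
    Nonempty (CategoryTheory.Quotient r ≌ B) :=
  have := isEquivalence_quotient_lift r F hF
  ⟨(CategoryTheory.Quotient.lift r F fun _ _ f g h => (hF f g).2 h).asEquivalence⟩

end Quotient

/-! ### Morphisms in quotients of full subcategories -/

section SubQuotient

variable {A : Type u} [Category.{v} A] [Preadditive A]

/-- Since `D ≤ N`, every factorization through `D` in `A` already takes place in `N`. -/
lemma mem_factorIdeal_inverseImage_iff [HasBinaryBiproducts A] {N D : ObjectProperty A}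
    (hDN : D ≤ N) (h0 : ∃ Z, D Z) (hD : ClosedUnderDirectSums D) {X Y : N.FullSubcategory}
    (f : X ⟶ Y) :
    f ∈ factorIdeal (D.inverseImage N.ι) X Y ↔ FactorsThrough D f.hom := by
  constructor
  · intro hf
    rw [← mem_factorIdeal_iff h0 hD]
    induction hf using AddSubgroup.closure_induction with
    | mem f hf =>
      obtain ⟨Z, a, b, hZ, rfl⟩ := hf
      exact AddSubgroup.subset_closure ⟨Z.obj, a.hom, b.hom, hZ, rfl⟩
    | zero => exact zero_mem _
    | add f g _ _ hf hg => exact add_mem hf hg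
    | neg f _ hf => exact neg_mem hf
  · rintro ⟨Z, a, b, hZ, h⟩
    exact AddSubgroup.subset_closure
      ⟨⟨Z, hDN _ hZ⟩, ObjectProperty.homMk a, ObjectProperty.homMk b, hZ, by ext1; exact h⟩

lemma FactorsThrough.neg {D : ObjectProperty A} {X Y : A} {f : X ⟶ Y}
    (hf : FactorsThrough D f) : FactorsThrough D (-f) := by
  obtain ⟨Z, a, b, hZ, rfl⟩ := hf
  exact ⟨Z, a, -b, hZ, by simp⟩

variable (N D : ObjectProperty A)

/-- The morphism of `N/[D]` represented by a morphism of the ambient category. -/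
def quot {X Y : N.FullSubcategory} (f : X.obj ⟶ Y.obj) :
    (⟨X⟩ : SubQuotient N D) ⟶ ⟨Y⟩ :=
  (CategoryTheory.Quotient.functor (idealRel (D.inverseImage N.ι))).map (ObjectProperty.homMk f)

lemma quot_surjective {X Y : N.FullSubcategory} (u : (⟨X⟩ : SubQuotient N D) ⟶ ⟨Y⟩) :
    ∃ f, quot N D f = u := by
  obtain ⟨f, rfl⟩ := (CategoryTheory.Quotient.functor
    (idealRel (D.inverseImage N.ι))).map_surjective u
  exact ⟨f.hom, rfl⟩

lemma quot_comp {X Y Z : N.FullSubcategory} (f : X.obj ⟶ Y.obj) (g : Y.obj ⟶ Z.obj) :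
    quot N D (f ≫ g) = quot N D f ≫ quot N D g := rfl

lemma quot_id (X : N.FullSubcategory) : quot N D (𝟙 X.obj) = 𝟙 (⟨X⟩ : SubQuotient N D) := rfl

lemma quot_sub {X Y : N.FullSubcategory} (f g : X.obj ⟶ Y.obj) :
    quot N D (f - g) = quot N D f - quot N D g := by
  rw [sub_eq_add_neg, sub_eq_add_neg]; rfl

variable {N D} in
lemma quot_eq_iff [HasBinaryBiproducts A] (hDN : D ≤ N) (h0 : ∃ Z, D Z)
    (hD : ClosedUnderDirectSums D) {X Y : N.FullSubcategory} (f g : X.obj ⟶ Y.obj) :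
    quot N D f = quot N D g ↔ FactorsThrough D (f - g) :=
  (CategoryTheory.Quotient.functor_map_eq_iff _ _ _).trans
    (mem_factorIdeal_inverseImage_iff hDN h0 hD _)

end SubQuotient

/-! ### Resolutions by objects of `M`, and factorization through `M` and `ΩM` -/

namespace Extriangulated

variable {C : Type u} [Category.{v} C] [Preadditive C] [HasZeroObject C] [HasBinaryBiproducts C]
variable {S : Extriangulated.{w} C} {M : ObjectProperty C}

lemma closedUnderDirectSums_projectives : ClosedUnderDirectSums S.projectives :=
  fun P Q hP hQ => ⟨P ⊞ Q, fun _ _ y hy c => by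
    obtain ⟨b, hb⟩ := hP y hy (biprod.inl ≫ c)
    obtain ⟨b', hb'⟩ := hQ y hy (biprod.inr ≫ c)
    exact ⟨biprod.desc b b', by ext <;> simp [hb, hb']⟩, ⟨Iso.refl _⟩⟩

lemma exists_projectives : ∃ Z, S.projectives Z := ⟨_, projectives_of_isZero (isZero_zero C)⟩

lemma closedUnderDirectSums_cocone {P Q : ObjectProperty C} (hP : ClosedUnderDirectSums P)
    (hQ : ClosedUnderDirectSums Q) : ClosedUnderDirectSums (S.cocone P Q) := by
  rintro X X' ⟨Y, Z, x, y, hY, hZ, δ, h⟩ ⟨Y', Z', x', y', hY', hZ', δ', h'⟩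
  obtain ⟨Y'', hY'', ⟨e⟩⟩ := hP hY hY'
  obtain ⟨Z'', hZ'', ⟨e'⟩⟩ := hQ hZ hZ'
  exact ⟨X ⊞ X', ⟨Y'', Z'', biprod.map x x' ≫ e.inv, e.hom ≫ biprod.map y y' ≫ e'.inv, hY'', hZ'',
    IsConflation.of_iso ⟨_, S.triangle_sum h h'⟩ (Iso.refl _) e.symm e'.symm (by simp)
      (by simp)⟩, ⟨Iso.refl _⟩⟩

lemma le_cocone {P Q : ObjectProperty C} {O : C} (hO : IsZero O) (hQ : Q O) :
    P ≤ S.cocone P Q :=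
  fun X hX => ⟨X, O, 𝟙 X, 0, hX, hQ, 0, triangle_id_zero hO X⟩

lemma cocone_mono {P P' Q : ObjectProperty C} (h : P ≤ P') : S.cocone P Q ≤ S.cocone P' Q :=
  fun _ ⟨Y, Z, x, y, hY, hZ, hxy⟩ => ⟨Y, Z, x, y, h _ hY, hZ, hxy⟩

variable (S M) in
/-- An `𝔰`-triangle `X ⟶ Y ⟶ Z` with `Y` and `Z` in `M`. -/
structure Resolution (X : C) where
  Y : M.FullSubcategory
  Z : M.FullSubcategory
  x : X ⟶ Y.obj
  y : Y.obj ⟶ Z.obj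
  δ : Ext S.E Z.obj X
  isTriangle : S.IsTriangle x y δ

section Triangle

variable {X Y Z X' Y' Z' : C} {x : X ⟶ Y} {y : Y ⟶ Z} {δ : Ext S.E Z X}
  {x' : X' ⟶ Y'} {y' : Y' ⟶ Z'} {δ' : Ext S.E Z' X'}

/-- A morphism into the third term of a triangle that factors through a projective lifts. -/
lemma IsTriangle.exists_lift_of_factorsThrough (h : S.IsTriangle x y δ) {W : C} {f : W ⟶ Z}
    (hf : FactorsThrough S.projectives f) :
    ∃ t : W ⟶ Y, FactorsThrough S.projectives t ∧ t ≫ y = f := by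
  obtain ⟨P, u, v, hP, rfl⟩ := hf
  obtain ⟨v', rfl⟩ := hP y ⟨X, x, δ, h⟩ v
  exact ⟨u ≫ v', ⟨P, u, v', hP, rfl⟩, by simp⟩

/-- If `φ` factors through `W` in `M`, then `φ_* δ` comes from `𝔼(Z, W) = 0`; if `φ_* δ = 0`, then
`φ` extends along `x` and so factors through `Y`. -/
lemma IsTriangle.factorsThrough_iff (h : S.IsTriangle x y δ) (hrigid : S.IsRigid M) (hY : M Y)
    (hZ : M Z) (φ : X ⟶ X') : FactorsThrough M φ ↔ push S.E φ δ = 0 := by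
  constructor
  · rintro ⟨W, a, b, hW, rfl⟩
    rw [push_comp, hrigid hZ hW (push S.E a δ), push_zero]
  · intro hφ
    obtain ⟨b, rfl⟩ := h.exists_desc_of_push_eq_zero φ hφ
    exact ⟨Y, x, b, hY, rfl⟩

/-- Allowing an error through projectives costs nothing, since such an error lifts along the
deflation `y`. -/
lemma IsTriangle.pull_eq_zero_iff (h : S.IsTriangle x y δ) {W : C} (c : W ⟶ Z) :
    pull S.E c δ = 0 ↔ ∃ s : W ⟶ Y, FactorsThrough S.projectives (s ≫ y - c) := by
  constructor
  · intro hc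
    obtain ⟨s, rfl⟩ := h.exists_lift_of_pull_eq_zero c hc
    exact ⟨s, _, 0, 0, projectives_of_isZero (isZero_zero C), by simp⟩
  · rintro ⟨s, hs⟩
    obtain ⟨t, -, ht⟩ := h.exists_lift_of_factorsThrough hs
    have : c = (s - t) ≫ y := by simp [ht]
    rw [this, pull_comp, h.pull_eq_zero, pull_zero]

/-- If a morphism of triangles has a middle component which is, up to projectives, null-homotopic,
then its first component factors through a cocone of a projective. -/
lemma IsTriangle.factorsThrough_cocone (h' : S.IsTriangle x' y' δ')
    (hS : S.EnoughProjectives) (hM : ClosedUnderDirectSums M) (hPM : S.projectives ≤ M)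
    (hZ' : M Z') (hxy : x ≫ y = 0) {φ : X ⟶ X'} {a : Y ⟶ Y'} (ha : x ≫ a = φ ≫ x')
    {s : Z ⟶ Y'} (hs : FactorsThrough S.projectives (y ≫ s - a)) :
    FactorsThrough (S.cocone S.projectives M) φ := by
  obtain ⟨P, u, v, hP, huv⟩ := hs.neg
  obtain ⟨K, P₁, k, p, hP₁, hkp⟩ := hS Z'
  -- Base change along `p : P₁ ⟶ Z'`: the triangle `X' ⟶ W ⟶ P₁` splits, giving the retraction `r`
  -- of `m₁`, while `K ⟶ W ⟶ Y'` has its first term `K` in `ΩM`.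
  obtain ⟨W, m₁, e₁, m₂, e₂, ⟨ε, h₁⟩, ⟨ε', h₂⟩, h₃, h₄⟩ := exists_base_change ⟨δ', h'⟩ hkp
  obtain ⟨r, hr⟩ := h₁.exists_desc_of_push_eq_zero (𝟙 X') (by
    rw [projectives_iff.1 hP₁ _ ε, push_zero])
  obtain ⟨v', rfl⟩ := hP e₁ ⟨K, m₂, ε', h₂⟩ v
  -- Under `e₁` both terms become `φ ≫ x'`, because `x ≫ y = 0`. So the difference factors through
  -- `K`, and applying `r` splits `φ` into a part through `P` and a part through `K`.
  obtain ⟨j, hj⟩ := h₂.exists_lift (φ ≫ m₁ - x ≫ u ≫ v') (by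
    have := congrArg (x ≫ ·) huv
    simp only [neg_sub, Preadditive.comp_sub, reassoc_of% hxy, zero_comp, sub_zero, ha] at this
    simp [h₃, ← this])
  have hO := hPM _ (projectives_of_isZero (S := S) (isZero_zero C))
  have hφ : φ = x ≫ u ≫ v' ≫ r + j ≫ m₂ ≫ r := by
    have := congrArg (· ≫ r) hj
    simp only [Preadditive.sub_comp, Category.assoc, hr, Category.comp_id] at this
    rw [this]; simp
  have hPc := le_cocone (S := S) (P := S.projectives) (isZero_zero C) hO
  rw [← mem_factorIdeal_iff ⟨_, hPc _ (projectives_of_isZero (isZero_zero C))⟩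
    (closedUnderDirectSums_cocone closedUnderDirectSums_projectives hM), hφ]
  exact add_mem (AddSubgroup.subset_closure ⟨P, x ≫ u, v' ≫ r, hPc _ hP, by simp⟩)
    (AddSubgroup.subset_closure ⟨K, j, m₂ ≫ r, ⟨P₁, Z', k, p, hP₁, hZ', hkp⟩, rfl⟩)

/-- Let `φ` factor through `K` with a triangle `K ⟶ P ⟶ M'`. Rigidity extends `X ⟶ K ⟶ P` to `u : Y
⟶ P` and `K ⟶ X' ⟶ Y'` to `v : P ⟶ Y'`; then `a - u ≫ v` kills `x`, so it factors through `y`. -/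
lemma IsTriangle.exists_factorsThrough (h : S.IsTriangle x y δ) (hrigid : S.IsRigid M)
    (hPM : S.projectives ≤ M) (hZ : M Z) (hY' : M Y') {φ : X ⟶ X'}
    (hφ : FactorsThrough (S.cocone S.projectives M) φ) {a : Y ⟶ Y'} (ha : x ≫ a = φ ≫ x') :
    ∃ s : Z ⟶ Y', FactorsThrough S.projectives (y ≫ s - a) := by
  obtain ⟨K, i, j, ⟨P, M', k, p, hP, hM', ρ, hρ⟩, rfl⟩ := hφ
  obtain ⟨v, hv⟩ := hρ.exists_desc_of_push_eq_zero (j ≫ x') (hrigid hM' hY' _)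
  obtain ⟨u, hu⟩ := h.exists_desc_of_push_eq_zero (i ≫ k) (hrigid hZ (hPM _ hP) _)
  obtain ⟨s, hs⟩ := h.exists_desc (a - u ≫ v) (by simp [ha, reassoc_of% hu, hv])
  exact ⟨s, P, u, -v, hP, by simp [hs]⟩

/-- Squares that commute up to projectives lift to morphisms of triangles. -/
lemma IsTriangle.exists_hom (h : S.IsTriangle x y δ) (h' : S.IsTriangle x' y' δ')
    (a : Y ⟶ Y') (c : Z ⟶ Z') (hac : FactorsThrough S.projectives (a ≫ y' - y ≫ c)) :
    ∃ (φ : X ⟶ X') (a' : Y ⟶ Y'), FactorsThrough S.projectives (a' - a) ∧ x ≫ a' = φ ≫ x' ∧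
      push S.E φ δ = pull S.E c δ' := by
  obtain ⟨t, ht, ht'⟩ := h'.exists_lift_of_factorsThrough hac
  obtain ⟨φ, h1, h2⟩ := S.et3_op h h' (a - t) c (by simp [ht'])
  exact ⟨φ, a - t, by simpa using ht.neg, h1, h2⟩

end Triangle

lemma Resolution.nonempty {X : C} (hX : S.cocone M M X) : Nonempty (S.Resolution M X) := by
  obtain ⟨Y, Z, x, y, hY, hZ, δ, h⟩ := hX
  exact ⟨⟨⟨Y, hY⟩, ⟨Z, hZ⟩, x, y, δ, h⟩⟩

lemma Resolution.cocone {X : C} (ρ : S.Resolution M X) : S.cocone M M X :=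
  ⟨_, _, _, _, ρ.Y.property, ρ.Z.property, ρ.δ, ρ.isTriangle⟩

/-- Up to isomorphism, every morphism of `M/[𝒫]` is the deflation of a resolution. -/
lemma Resolution.exists_iso (hS : S.EnoughProjectives) (hM : ClosedUnderDirectSums M)
    (hPM : S.projectives ≤ M) (f : Arrow (SubQuotient M S.projectives)) :
    ∃ (X : C) (ρ : S.Resolution M X),
      Nonempty (Arrow.mk (quot M S.projectives ρ.y) ≅ f) := by
  obtain ⟨⟨Y⟩, ⟨Z⟩, f⟩ := f
  obtain ⟨g, rfl⟩ := quot_surjective _ _ f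
  obtain ⟨K, P, k, p, hP, hkp⟩ := hS Z.obj
  obtain ⟨W, hW, ⟨e⟩⟩ := hM Y.property (hPM _ hP)
  -- `(g, p) : Y ⊞ P ⟶ Z` is a deflation, and it agrees with `g` in `M/[𝒫]`, where `P` becomes zero.
  obtain ⟨X, x, δ, h⟩ := IsDeflation.desc ⟨K, k, hkp⟩ g
  have h' := S.triangle_of_equivalent h (y' := e.hom ≫ biprod.desc g p) e.symm rfl (by simp)
  refine ⟨X, ⟨⟨W, hW⟩, Z, _, _, _, h'⟩, ⟨Arrow.isoMk
    ⟨quot M _ (X := ⟨W, hW⟩) (Y := Y) (e.hom ≫ biprod.fst),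
      quot M _ (X := Y) (Y := ⟨W, hW⟩) (biprod.inl ≫ e.inv), ?_, ?_⟩ (Iso.refl _) ?_⟩⟩
  · rw [← quot_comp, ← quot_id, quot_eq_iff hPM exists_projectives
      closedUnderDirectSums_projectives]
    refine ⟨P, e.hom ≫ biprod.snd, -biprod.inr ≫ e.inv, hP, ?_⟩
    rw [← cancel_epi e.inv, ← cancel_mono e.hom]
    ext <;> simp
  · rw [← quot_comp, ← quot_id]
    simp
  · dsimp
    rw [← quot_id, ← quot_comp, ← quot_comp, quot_eq_iff hPM exists_projectives
      closedUnderDirectSums_projectives]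
    refine ⟨P, e.hom ≫ biprod.snd, -p, hP, ?_⟩
    rw [← cancel_epi e.inv]
    ext <;> simp

end Extriangulated

/-- The relation on the opposite category corresponding to `r`. -/
def opRel {N : Type*} [Category* N] (r : HomRel N) : HomRel Nᵒᵖ := fun _ _ f g => r f.unop g.unop

instance {N : Type*} [Category* N] (r : HomRel N) [Congruence r] : Congruence (opRel r) where
  equivalence := ⟨fun f => (Congruence.equivalence (r := r)).refl f.unop,
    fun h => (Congruence.equivalence (r := r)).symm h,
    fun h h' => (Congruence.equivalence (r := r)).trans h h'⟩
  comp_left f _ _ h := HomRel.IsStableUnderPostcomp.comp_right (r := r) f.unop h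
  comp_right g h := HomRel.IsStableUnderPrecomp.comp_left (r := r) g.unop h

namespace Presentation

variable {N : Type*} [Category* N] {r : HomRel N} [Congruence r] {A : Type u} [Category.{v} A]
  [Preadditive A]

lemma nonempty_equivalence (R : Presentation r A) :
    Nonempty (CategoryTheory.Quotient r ≌ FpMod A) :=
  nonempty_quotient_equivalence r R.functor R.functor_map_eq_iff

lemma nonempty_equivalence_op (R : Presentation (opRel r) A) :
    Nonempty (CategoryTheory.Quotient r ≌ (FpMod A)ᵒᵖ) :=
  nonempty_quotient_equivalence r R.functor.rightOp fun f g =>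
    Quiver.Hom.op_inj.eq_iff.trans (R.functor_map_eq_iff f.op g.op)

end Presentation

/-! ### The two equivalences for `M_L` -/

namespace Extriangulated

variable {C : Type u} [Category.{v} C] [Preadditive C] [HasZeroObject C] [HasBinaryBiproducts C]
variable {S : Extriangulated.{w} C} {M : ObjectProperty C}

/-- The presentation of `M_L/[M]` by morphisms of `M/[𝒫]`. -/
def presentation (hM : ClosedUnderDirectSums M) (hrigid : S.IsRigid M)
    (hS : S.EnoughProjectives) (hPM : S.projectives ≤ M) :
    Presentation (idealRel (M.inverseImage (S.cocone M M).ι)) (SubQuotient M S.projectives) where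
  Res X := S.Resolution M X.obj
  d ρ := Arrow.mk (quot M S.projectives ρ.y)
  Rel ρ ρ' φ b := ∃ c : ρ.Z.obj ⟶ ρ'.Z.obj, quot M S.projectives c = b ∧
    push S.E φ.hom ρ.δ = pull S.E c ρ'.δ
  nonempty X := Resolution.nonempty X.property
  rel_square {X X' ρ ρ' φ b} := by
    rintro ⟨c, rfl, hc⟩
    obtain ⟨a, -, ha⟩ := S.realize_hom ρ.isTriangle ρ'.isTriangle φ.hom c hc
    exact ⟨quot M S.projectives a, by
      dsimp
      rw [← quot_comp, ← quot_comp, ha]⟩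
  exists_rel {X X'} ρ ρ' φ := by
    -- Pushed to `Y'`, the class `φ_* δ` lands in `𝔼(Z, Y') = 0`.
    obtain ⟨c, hc⟩ := ρ'.isTriangle.exists_pull_eq (push S.E φ.hom ρ.δ)
      (hrigid ρ.Z.property ρ'.Y.property _)
    exact ⟨_, c, rfl, hc.symm⟩
  rel_id ρ := ⟨𝟙 _, rfl, by simp⟩
  rel_comp {X X' X'' ρ ρ' ρ'' φ φ' b b'} := by
    rintro ⟨c, rfl, hc⟩ ⟨c', rfl, hc'⟩
    exact ⟨c ≫ c', rfl, by
      rw [ObjectProperty.FullSubcategory.comp_hom, push_comp, hc, ← pull_push, hc', pull_comp]⟩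
  rel_iff {X X' ρ ρ' φ φ' b b'} := by
    rintro ⟨c, rfl, hc⟩ ⟨c', rfl, hc'⟩
    have hO := hPM _ (projectives_of_isZero (S := S) (isZero_zero C))
    refine (mem_factorIdeal_inverseImage_iff (le_cocone (isZero_zero C) hO) ⟨_, hO⟩ hM _).trans ?_
    change FactorsThrough M (φ.hom - φ'.hom) ↔ _
    -- Factoring through `M` means `(φ - φ')_* δ = 0`; this class is `(c - c')^* δ'`, whose
    -- vanishing is a null-homotopy in `M/[𝒫]`.
    rw [ρ.isTriangle.factorsThrough_iff hrigid ρ.Y.property ρ.Z.property, sub_push, hc, hc',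
      ← sub_pull, ρ'.isTriangle.pull_eq_zero_iff]
    dsimp
    rw [← quot_sub]
    constructor
    · rintro ⟨s, hs⟩
      refine ⟨quot M S.projectives s, ?_⟩
      rwa [← quot_comp, quot_eq_iff hPM exists_projectives closedUnderDirectSums_projectives]
    · rintro ⟨s, hs⟩
      obtain ⟨s, rfl⟩ := quot_surjective _ _ s
      refine ⟨s, ?_⟩
      rwa [← quot_comp, quot_eq_iff hPM exists_projectives closedUnderDirectSums_projectives] at hs
  exists_hom {X X'} ρ ρ' a b hab := by
    obtain ⟨a, rfl⟩ := quot_surjective _ _ a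
    obtain ⟨c, rfl⟩ := quot_surjective _ _ b
    dsimp at hab
    rw [← quot_comp, ← quot_comp,
      quot_eq_iff hPM exists_projectives closedUnderDirectSums_projectives] at hab
    obtain ⟨φ, -, -, -, hφ⟩ := ρ.isTriangle.exists_hom ρ'.isTriangle a c hab
    exact ⟨ObjectProperty.homMk φ, c, rfl, hφ⟩
  exists_res f := by
    obtain ⟨X, ρ, h⟩ := Resolution.exists_iso hS hM hPM f
    exact ⟨⟨X, ρ.cocone⟩, ρ, h⟩

/-- The presentation of `(M_L/[ΩM])ᵒᵖ` by morphisms of `(M/[𝒫])ᵒᵖ`. -/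
def presentationOp (hM : ClosedUnderDirectSums M) (hrigid : S.IsRigid M)
    (hS : S.EnoughProjectives) (hPM : S.projectives ≤ M) :
    Presentation (opRel (idealRel ((S.cocone S.projectives M).inverseImage (S.cocone M M).ι)))
      (SubQuotient M S.projectives)ᵒᵖ where
  Res X := S.Resolution M X.unop.obj
  d ρ := Arrow.mk (quot M S.projectives ρ.y).op
  -- In the opposite category the target of the presenting arrow is `Y`, so a morphism is recorded
  -- by its component on middle terms.
  Rel ρ ρ' φ b := ∃ a : ρ'.Y.obj ⟶ ρ.Y.obj, (quot M S.projectives a).op = b ∧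
    ρ'.x ≫ a = φ.unop.hom ≫ ρ.x
  nonempty X := Resolution.nonempty X.unop.property
  rel_square {X X' ρ ρ' φ b} := by
    rintro ⟨a, rfl, ha⟩
    obtain ⟨c, hc, -⟩ := S.et3 ρ'.isTriangle ρ.isTriangle φ.unop.hom a ha
    exact ⟨(quot M S.projectives c).op, by
      dsimp
      rw [← op_comp, ← op_comp, ← quot_comp, ← quot_comp, hc]⟩
  exists_rel {X X'} ρ ρ' φ := by
    obtain ⟨a, ha⟩ := ρ'.isTriangle.exists_desc_of_push_eq_zero (φ.unop.hom ≫ ρ.x)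
      (hrigid ρ'.Z.property ρ.Y.property _)
    exact ⟨_, a, rfl, ha⟩
  rel_id ρ := ⟨𝟙 _, rfl, by simp⟩
  rel_comp {X X' X'' ρ ρ' ρ'' φ φ' b b'} := by
    rintro ⟨a, rfl, ha⟩ ⟨a', rfl, ha'⟩
    exact ⟨a' ≫ a, rfl, by simp [reassoc_of% ha', ha]⟩
  rel_iff {X X' ρ ρ' φ φ' b b'} := by
    rintro ⟨a, rfl, ha⟩ ⟨a', rfl, ha'⟩
    have hO := projectives_of_isZero (S := S) (isZero_zero C)
    refine (mem_factorIdeal_inverseImage_iff (cocone_mono hPM)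
      ⟨_, le_cocone (isZero_zero C) (hPM _ hO) _ hO⟩
      (closedUnderDirectSums_cocone closedUnderDirectSums_projectives hM) _).trans ?_
    change FactorsThrough _ (φ.unop.hom - φ'.unop.hom) ↔ _
    have haa : ρ'.x ≫ (a - a') = (φ.unop.hom - φ'.unop.hom) ≫ ρ.x := by simp [ha, ha']
    dsimp
    constructor
    · intro h
      obtain ⟨s, hs⟩ := ρ'.isTriangle.exists_factorsThrough hrigid hPM ρ'.Z.property
        ρ.Y.property h haa
      refine ⟨(quot M S.projectives s).op, ?_⟩
      rwa [← op_comp, ← quot_comp, ← op_sub, ← quot_sub, Quiver.Hom.op_inj.eq_iff,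
        quot_eq_iff hPM exists_projectives closedUnderDirectSums_projectives]
    · rintro ⟨s, hs⟩
      obtain ⟨s, rfl⟩ : ∃ t, Quiver.Hom.op t = s := ⟨s.unop, rfl⟩
      obtain ⟨s, rfl⟩ := quot_surjective _ _ s
      rw [← op_comp, ← quot_comp, ← op_sub, ← quot_sub, Quiver.Hom.op_inj.eq_iff,
        quot_eq_iff hPM exists_projectives closedUnderDirectSums_projectives] at hs
      exact ρ.isTriangle.factorsThrough_cocone hS hM hPM ρ.Z.property ρ'.isTriangle.comp_zero
        haa hs
  exists_hom {X X'} ρ ρ' a b hab := by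
    obtain ⟨b, rfl⟩ : ∃ t, Quiver.Hom.op t = b := ⟨b.unop, rfl⟩
    obtain ⟨a, rfl⟩ : ∃ t, Quiver.Hom.op t = a := ⟨a.unop, rfl⟩
    obtain ⟨c, rfl⟩ := quot_surjective _ _ a
    obtain ⟨a, rfl⟩ := quot_surjective _ _ b
    dsimp at hab
    rw [← op_comp, ← op_comp, ← quot_comp, ← quot_comp, Quiver.Hom.op_inj.eq_iff, eq_comm,
      quot_eq_iff hPM exists_projectives closedUnderDirectSums_projectives] at hab
    obtain ⟨φ, a', ha, hφ, -⟩ := ρ'.isTriangle.exists_hom ρ.isTriangle a c hab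
    exact ⟨(ObjectProperty.homMk φ : X'.unop ⟶ X.unop).op, a',
      congrArg _ ((quot_eq_iff hPM exists_projectives closedUnderDirectSums_projectives _ _).2 ha),
      hφ⟩
  exists_res f := by
    obtain ⟨X, ρ, ⟨e⟩⟩ := Resolution.exists_iso hS hM hPM (Arrow.mk f.hom.unop)
    exact ⟨op ⟨X, ρ.cocone⟩, ρ, ⟨Arrow.isoMk (Arrow.rightFunc.mapIso e).op.symm
      (Arrow.leftFunc.mapIso e).op.symm (Quiver.Hom.unop_inj e.inv.w.symm)⟩⟩

theorem nonempty_equivalences_of_enoughProjectives (hM : ClosedUnderDirectSums M)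
    (hrigid : S.IsRigid M) (hS : S.EnoughProjectives) (hPM : S.projectives ≤ M) :
    Nonempty (SubQuotient (S.cocone M M) M ≌ FpMod (SubQuotient M S.projectives)) ∧
      Nonempty (SubQuotient (S.cocone M M) (S.cocone S.projectives M) ≌
        (FpMod (SubQuotient M S.projectives)ᵒᵖ)ᵒᵖ) :=
  ⟨(presentation hM hrigid hS hPM).nonempty_equivalence,
    (presentationOp hM hrigid hS hPM).nonempty_equivalence_op⟩

end Extriangulated

/-! ### Finitely presented modules over equivalent categories -/

section Homotopy

variable {A : Type u} [Category.{v} A] [Preadditive A]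

/-- The homotopy relation on morphisms of arrows. -/
def homotopyRel (A : Type u) [Category.{v} A] [Preadditive A] : HomRel (Arrow A) :=
  fun f g φ φ' => ∃ s : f.right ⟶ g.left, s ≫ g.hom = φ.right - φ'.right

instance : Congruence (homotopyRel A) where
  equivalence := ⟨fun _ => ⟨0, by simp⟩, fun ⟨s, hs⟩ => ⟨-s, by simp [hs]⟩,
    fun ⟨s, hs⟩ ⟨s', hs'⟩ => ⟨s + s', by simp [hs, hs']⟩⟩
  comp_left f _ _ := fun ⟨s, hs⟩ => ⟨f.right ≫ s, by simp [hs]⟩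
  comp_right g := fun ⟨s, hs⟩ => ⟨s ≫ g.left, by
    simp [reassoc_of% hs]⟩

/-- The presentation of the homotopy category of arrows of `A` by morphisms of an equivalent
category. -/
def Presentation.ofEquivalence {A' : Type u} [Category.{v} A'] [Preadditive A'] (F : A ⥤ A')
    [F.Additive] [F.IsEquivalence] : Presentation (homotopyRel A) A' where
  Res _ := PUnit.{1}
  d {X} _ := Arrow.mk (F.map X.hom)
  Rel _ _ φ b := F.map φ.right = b
  nonempty _ := ⟨⟨⟩⟩
  rel_square {X X' _ _ φ b} := by
    rintro rfl
    exact ⟨F.map φ.left, (F.mapArrow.map φ).w⟩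
  exists_rel _ _ _ := ⟨_, rfl⟩
  rel_id _ := F.map_id _
  rel_comp := by
    rintro _ _ _ _ _ _ _ _ _ _ rfl rfl
    exact F.map_comp _ _
  rel_iff {X X' _ _ φ φ' b b'} := by
    rintro rfl rfl
    constructor
    · rintro ⟨s, hs⟩
      exact ⟨F.map s, by
        dsimp
        rw [← F.map_comp, hs, F.map_sub]⟩
    · rintro ⟨s, hs⟩
      obtain ⟨s, rfl⟩ := F.map_surjective s
      exact ⟨s, F.map_injective (by simpa using hs)⟩
  exists_hom _ _ a b hab := by
    obtain ⟨a, rfl⟩ := F.map_surjective a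
    obtain ⟨b, rfl⟩ := F.map_surjective b
    exact ⟨Arrow.homMk a b (F.map_injective (by simpa using hab)), rfl⟩
  exists_res f := ⟨F.mapArrow.objPreimage f, ⟨⟩, ⟨F.mapArrow.objObjPreimageIso f⟩⟩

/-- Both module categories are the quotient of `Arrow A` by homotopy. -/
lemma nonempty_fpMod_equivalence {A' : Type u} [Category.{v} A'] [Preadditive A'] (F : A ⥤ A')
    [F.Additive] [F.IsEquivalence] : Nonempty (FpMod A ≌ FpMod A') := by
  obtain ⟨e⟩ := (Presentation.ofEquivalence (𝟭 A)).nonempty_equivalence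
  obtain ⟨e'⟩ := (Presentation.ofEquivalence F).nonempty_equivalence
  exact ⟨e.symm.trans e'⟩

end Homotopy

/-! ### Quotients of opposite categories -/

section Opposite

variable {A : Type u} [Category.{v} A] [Preadditive A] (N D : ObjectProperty A)

lemma mem_factorIdeal_op_iff {X Y : N.op.FullSubcategory} (f : X ⟶ Y) :
    f ∈ factorIdeal (D.op.inverseImage N.op.ι) X Y ↔
      (N.opEquivalence.functor.map f).unop ∈ factorIdeal (D.inverseImage N.ι)
        (N.opEquivalence.functor.obj Y).unop (N.opEquivalence.functor.obj X).unop := by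
  constructor
  · intro hf
    induction hf using AddSubgroup.closure_induction with
    | mem f hf =>
      obtain ⟨Z, a, b, hZ, rfl⟩ := hf
      exact AddSubgroup.subset_closure ⟨⟨Z.obj.unop, Z.property⟩, ObjectProperty.homMk b.hom.unop,
        ObjectProperty.homMk a.hom.unop, hZ, rfl⟩
    | zero => exact zero_mem _
    | add f g _ _ hf hg => exact add_mem hf hg
    | neg f _ hf => exact neg_mem hf
  · intro hf
    suffices ∀ g : (N.opEquivalence.functor.obj Y).unop ⟶ (N.opEquivalence.functor.obj X).unop,
        g ∈ factorIdeal (D.inverseImage N.ι) _ _ →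
        (ObjectProperty.homMk g.hom.op : X ⟶ Y) ∈ factorIdeal (D.op.inverseImage N.op.ι) X Y from
      this _ hf
    intro g hg
    induction hg using AddSubgroup.closure_induction with
    | mem g hg =>
      obtain ⟨Z, a, b, hZ, rfl⟩ := hg
      exact AddSubgroup.subset_closure ⟨⟨op Z.obj, Z.property⟩, ObjectProperty.homMk b.hom.op,
        ObjectProperty.homMk a.hom.op, hZ, rfl⟩
    | zero => exact zero_mem _
    | add f g _ _ hf hg => exact add_mem hf hg
    | neg f _ hf => exact neg_mem hf

lemma subQuotientOp_map_eq_iff {X Y : N.op.FullSubcategory} (f g : X ⟶ Y) :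
    (N.opEquivalence.functor ⋙ (CategoryTheory.Quotient.functor
        (idealRel (D.inverseImage N.ι))).op).map f = (N.opEquivalence.functor ⋙
      (CategoryTheory.Quotient.functor (idealRel (D.inverseImage N.ι))).op).map g ↔
      idealRel (D.op.inverseImage N.op.ι) f g :=
  (Quiver.Hom.op_inj.eq_iff.trans (CategoryTheory.Quotient.functor_map_eq_iff _ _ _)).trans
    (mem_factorIdeal_op_iff N D (f - g)).symm

/-- The comparison of the quotients of a category and of its opposite. -/
def subQuotientOp : SubQuotient N.op D.op ⥤ (SubQuotient N D)ᵒᵖ :=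
  CategoryTheory.Quotient.lift _ (N.opEquivalence.functor ⋙ (CategoryTheory.Quotient.functor
    (idealRel (D.inverseImage N.ι))).op) fun _ _ f g h => (subQuotientOp_map_eq_iff N D f g).2 h

instance : (subQuotientOp N D).IsEquivalence :=
  isEquivalence_quotient_lift _ _ (subQuotientOp_map_eq_iff N D)

instance : (subQuotientOp N D).Additive where
  map_add {X Y f g} := by
    obtain ⟨f, rfl⟩ := (CategoryTheory.Quotient.functor _).map_surjective f
    obtain ⟨g, rfl⟩ := (CategoryTheory.Quotient.functor _).map_surjective g
    rfl

lemma ClosedUnderDirectSums.op [HasBinaryBiproducts A] {M : ObjectProperty A}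
    (hM : ClosedUnderDirectSums M) :
    ClosedUnderDirectSums M.op := by
  intro X Y hX hY
  obtain ⟨Z, hZ, ⟨e⟩⟩ := hM hX hY
  exact ⟨Opposite.op Z, hZ, ⟨(e ≪≫ biprodUnopIso X Y).op.symm⟩⟩

end Opposite

/-! ### Passage to the opposite category and the equivalences for `M_R` -/

namespace Extriangulated

variable {C : Type u} [Category.{v} C] [Preadditive C] [HasZeroObject C] [HasBinaryBiproducts C]
variable (S : Extriangulated.{w} C)

lemma opposite_isDeflation_iff {B Z : Cᵒᵖ} (y : B ⟶ Z) :
    S.opposite.IsDeflation y ↔ S.IsInflation y.unop :=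
  ⟨fun ⟨A, x, h⟩ => ⟨A.unop, x.unop, h⟩, fun ⟨A, x, h⟩ => ⟨op A, x.op, h⟩⟩

lemma opposite_projectives : S.opposite.projectives = S.injectives.op := by
  ext P
  constructor
  · intro h A B x hx a
    obtain ⟨b, hb⟩ := h x.op ((S.opposite_isDeflation_iff x.op).2 hx) a.op
    exact ⟨b.unop, Quiver.Hom.op_inj hb⟩
  · intro h B Z y hy c
    obtain ⟨b, hb⟩ := h y.unop ((S.opposite_isDeflation_iff y).1 hy) c.unop
    exact ⟨b.op, Quiver.Hom.unop_inj hb⟩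

lemma opposite_cocone (P Q : ObjectProperty C) :
    S.opposite.cocone P.op Q.op = (S.cone Q P).op := by
  ext X
  constructor
  · rintro ⟨Y, Z, x, y, hY, hZ, h⟩
    exact ⟨Z.unop, Y.unop, y.unop, x.unop, hZ, hY, h⟩
  · rintro ⟨Z, Y, y, x, hZ, hY, h⟩
    exact ⟨op Y, op Z, x.op, y.op, hY, hZ, h⟩

variable {S} {M : ObjectProperty C}

lemma EnoughInjectives.opposite (hS : S.EnoughInjectives) : S.opposite.EnoughProjectives := by
  intro Z
  obtain ⟨I, A, x, y, hI, h⟩ := hS Z.unop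
  exact ⟨op A, op I, y.op, x.op, by rw [opposite_projectives]; exact hI, h⟩

lemma IsRigid.opposite (hM : S.IsRigid M) : S.opposite.IsRigid M.op :=
  fun _ _ hX hY δ => hM hY hX δ

theorem nonempty_equivalences_of_enoughInjectives (hM : ClosedUnderDirectSums M)
    (hrigid : S.IsRigid M) (hS : S.EnoughInjectives) (hIM : S.injectives ≤ M) :
    Nonempty (SubQuotient (S.cone M M) M ≌ (FpMod (SubQuotient M S.injectives)ᵒᵖ)ᵒᵖ) ∧
      Nonempty (SubQuotient (S.cone M M) (S.cone M S.injectives) ≌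
        FpMod (SubQuotient M S.injectives)) := by
  have h := nonempty_equivalences_of_enoughProjectives hM.op hrigid.opposite hS.opposite
    (by rw [opposite_projectives]; exact fun X hX => hIM _ hX)
  rw [opposite_projectives, opposite_cocone, opposite_cocone] at h
  obtain ⟨⟨e₁⟩, ⟨e₂⟩⟩ := h
  -- `e₁` and `e₂` concern modules over the quotient formed in `Cᵒᵖ` and over its opposite; `i₁` and
  -- `i₂` rewrite these over `(M/[ℐ])ᵒᵖ` and `M/[ℐ]`.
  obtain ⟨i₁⟩ := nonempty_fpMod_equivalence (subQuotientOp M S.injectives)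
  obtain ⟨i₂⟩ := nonempty_fpMod_equivalence (subQuotientOp M S.injectives).leftOp
  exact ⟨⟨(opOpEquivalence _).symm.trans
      (((subQuotientOp (S.cone M M) M).asEquivalence.symm.trans (e₁.trans i₁)).op)⟩,
    ⟨(opOpEquivalence _).symm.trans
      (((subQuotientOp (S.cone M M) (S.cone M S.injectives)).asEquivalence.symm.trans
        (e₂.trans i₂.op)).op.trans (opOpEquivalence _))⟩⟩

end Extriangulated

end ExtriangulatedQuotients

theorem mainTheorem6 {C : Type u} [Category.{v} C] [Preadditive C] [HasZeroObject C]
    [HasBinaryBiproducts C] (S : ExtriangulatedQuotients.Extriangulated.{w} C)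
    (M : ObjectProperty C) (hM : ExtriangulatedQuotients.ClosedUnderDirectSums M)
    (hrigid : S.IsRigid M) :
    (S.EnoughProjectives → S.projectives ≤ M →
      Nonempty (ExtriangulatedQuotients.SubQuotient (S.cocone M M) M ≌
        ExtriangulatedQuotients.FpMod
          (ExtriangulatedQuotients.SubQuotient M S.projectives)) ∧
      Nonempty (ExtriangulatedQuotients.SubQuotient (S.cocone M M) (S.cocone S.projectives M) ≌
        (ExtriangulatedQuotients.FpMod
          (ExtriangulatedQuotients.SubQuotient M S.projectives)ᵒᵖ)ᵒᵖ)) ∧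
    (S.EnoughInjectives → S.injectives ≤ M →
      Nonempty (ExtriangulatedQuotients.SubQuotient (S.cone M M) M ≌
        (ExtriangulatedQuotients.FpMod
          (ExtriangulatedQuotients.SubQuotient M S.injectives)ᵒᵖ)ᵒᵖ) ∧
      Nonempty (ExtriangulatedQuotients.SubQuotient (S.cone M M) (S.cone M S.injectives) ≌
        ExtriangulatedQuotients.FpMod
          (ExtriangulatedQuotients.SubQuotient M S.injectives))) :=
  ⟨ExtriangulatedQuotients.Extriangulated.nonempty_equivalences_of_enoughProjectives hM hrigid,
    ExtriangulatedQuotients.Extriangulated.nonempty_equivalences_of_enoughInjectives hM hrigid⟩
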